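/- Let $n\ge 1$, $\nu,\mu\in\mathbb R$ with $\mu>0$, and let $L^2(\mathbb C^n)$ be taken with respect to Lebesgue measure. Put $|z|^2=\sum_j|z_j|^2$, $E=\sum_j z_j\partial_{z_j}$, $\overline E=\sum_j\bar z_j\partial_{\bar z_j}$, and $$\Delta_{\nu,\mu}=4\sum_{j=1}^n\frac{\partial^2}{\partial z_j\partial\bar z_j}+2(\mu+i\nu)E-2(\mu-i\nu)\overline E-(\nu^2+\mu^2)|z|^2+2i\nu n .$$ For $r,s\in\mathbb Z_{\ge0}^n$ let $$h_{r,s}^{\nu,\mu}=(a_1^+)^{r_1}\cdots(a_n^+)^{r_n}\Big(z^s e^{-\frac{\mu+i\nu}{2}|z|^2}\Big),\qquad a_j^+=-\frac{\partial}{\partial z_j}+\frac{\mu-i\nu}{2}\bar z_j ,$$ and for $\sigma>0$, $m,k\in\mathbb Z_{\ge 0}$, $\xi\in\mathbb C$ let $h^{\sigma}_{m,k}(\xi)=(-1)^{m+k}e^{\sigma|\xi|^2}\partial_\xi^m\partial_{\bar\xi}^k e^{-\sigma|\xi|^2}$. Write $|r|=\sum_j r_j$. Then: 1. Up to a Gaussian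 phase, the $h_{r,s}^{\nu,\mu}$ are products of univariate complex Hermite functions: $$h_{r,s}^{\nu,\mu}(z)=e^{-\frac{i\nu}{2}|z|^2}\,\mu^{-|s|}\prod_{j=1}^n e^{-\frac{\mu}{2}|z_j|^2}h^{\mu}_{r_j,s_j}(z_j).$$ 2. Each $h_{r,s}^{\nu,\mu}$ is smooth and satisfies $\Delta_{\nu,\mu}h_{r,s}^{\nu,\mu}=-2\mu(n+2|r|)\,h_{r,s}^{\nu,\mu}$. 3. The $h_{r,s}^{\nu,\mu}$ ($r,s\in\mathbb Z_{\ge0}^n$) form a complete orthogonal system in $L^2(\mathbb C^n)$: they are nonzero, square integrable, pairwise orthogonal, and their linear span is dense. 4. $L^2(\mathbb C^n)=\bigoplus_{l=0}^\infty \mathbf A_l$ (orthogonal Hilbert sum), where $\mathbf A_l$ is the closed linear span of $\{h_{r,s}^{\nu,\mu}: |r|=l\}$. 5. For every $l\ge 0$, $\mathbf A_l$ is the set of all $F\in L^2(\mathbb C^n)$ with $\Delta_{\nu,\mu}F=-2\mu(n+2l)F$ in the sense of distributions. Consequently the eigenvalues of $\Delta_{\nu,\mu}$ in $L^2(\mathbb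 C^n)$ are exactly the numbers $-2\mu(n+2l)$, $l=0,1,2,\dots$; that is, a number $c\in\mathbb C$ admits a nonzero $F\in L^2(\mathbb C^n)$ with $\Delta_{\nu,\mu}F=cF$ in the sense of distributions if and only if $c=-2\mu(n+2l)$ for some integer $l\ge0$, and the same holds for nonzero smooth $F\in C^\infty(\mathbb C^n)\cap L^2(\mathbb C^n)$. -/

import Mathlib

open MeasureTheory
open scoped ContDiff ComplexConjugate

noncomputable section

namespace Magnetic

/-- The Wirtinger derivative `∂/∂z` in the complex direction `v`:
`(1/2) (∂_v f - i ∂_{iv} f)`, where the derivatives are real directional derivatives.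
With `v = Pi.single j 1` this is `∂/∂z_j` on `ℂⁿ`; with `v = 1` it is `∂/∂z` on `ℂ`. -/
def dz {E : Type*} [NormedAddCommGroup E] [NormedSpace ℂ E] (v : E) (f : E → ℂ) : E → ℂ :=
  fun z => (1 / 2 : ℂ) *
    (fderiv ℝ f z v - Complex.I * fderiv ℝ f z (Complex.I • v))

/-- The Wirtinger derivative `∂/∂z̄` in the complex direction `v`. -/
def dzbar {E : Type*} [NormedAddCommGroup E] [NormedSpace ℂ E] (v : E) (f : E → ℂ) : E → ℂ :=
  fun z => (1 / 2 : ℂ) *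
    (fderiv ℝ f z v + Complex.I * fderiv ℝ f z (Complex.I • v))

/-- The `j`-th standard basis vector of `ℂⁿ`. -/
def e {n : ℕ} (j : Fin n) : Fin n → ℂ := Pi.single j 1

/-- `|z|² = ∑ |z_j|²`, the squared Euclidean norm on `ℂⁿ`. -/
def sqNorm {n : ℕ} (z : Fin n → ℂ) : ℝ := ∑ j, ‖z j‖ ^ 2

/-- The length `|r| = ∑ r_j` of a multi-index. -/
def len {n : ℕ} (r : Fin n → ℕ) : ℕ := ∑ j, r j

/-- The magnetic Laplacian
`4 ∑ ∂²/∂z_j∂z̄_j + 2(μ+iν) E - 2(μ-iν) Ē - (ν²+μ²)|z|² + 2iνn`,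
where `E = ∑ z_j ∂/∂z_j` and `Ē = ∑ z̄_j ∂/∂z̄_j`. -/
def laplacian {n : ℕ} (ν μ : ℝ) (f : (Fin n → ℂ) → ℂ) : (Fin n → ℂ) → ℂ :=
  fun z =>
    4 * ∑ j, dz (e j) (dzbar (e j) f) z
      + 2 * ((μ : ℂ) + Complex.I * ν) * ∑ j, z j * dz (e j) f z
      - 2 * ((μ : ℂ) - Complex.I * ν) * ∑ j, conj (z j) * dzbar (e j) f z
      - ((ν : ℂ) ^ 2 + (μ : ℂ) ^ 2) * (sqNorm z : ℂ) * f z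
      + 2 * Complex.I * ν * n * f z

/-- The creation operator `a_j⁺ = -∂/∂z_j + ((μ-iν)/2) z̄_j`. -/
def creation {n : ℕ} (ν μ : ℝ) (j : Fin n) (f : (Fin n → ℂ) → ℂ) : (Fin n → ℂ) → ℂ :=
  fun z => -dz (e j) f z + ((μ : ℂ) - Complex.I * ν) / 2 * conj (z j) * f z

/-- The lowest-level functions `z^s exp(-((μ+iν)/2)|z|²)`. -/
def ground {n : ℕ} (ν μ : ℝ) (s : Fin n → ℕ) : (Fin n → ℂ) → ℂ :=
  fun z => (∏ j, z j ^ s j) *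
    Complex.exp (-(((μ : ℂ) + Complex.I * ν) / 2) * (sqNorm z : ℂ))

/-- `h_{r,s} = (a_1⁺)^{r_1} ⋯ (a_n⁺)^{r_n} (z^s exp(-((μ+iν)/2)|z|²))`. -/
def h {n : ℕ} (ν μ : ℝ) (r s : Fin n → ℕ) : (Fin n → ℂ) → ℂ :=
  (List.finRange n).foldr (fun j f => (creation ν μ j)^[r j] f) (ground ν μ s)

/-- The univariate complex Hermite functions
`h^σ_{m,k}(ξ) = (-1)^{m+k} exp(σ|ξ|²) ∂^{m+k}/∂ξ^m∂ξ̄^k exp(-σ|ξ|²)`. -/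
def complexHermite (σ : ℝ) (m k : ℕ) : ℂ → ℂ :=
  fun ξ => (-1) ^ (m + k) * Complex.exp ((σ : ℂ) * ((‖ξ‖ ^ 2 : ℝ) : ℂ)) *
    ((dz (1 : ℂ))^[m] ((dzbar (1 : ℂ))^[k]
      (fun w => Complex.exp (-(σ : ℂ) * ((‖w‖ ^ 2 : ℝ) : ℂ))))) ξ

/-- The Hilbert space `L²(ℂⁿ)` for Lebesgue measure. -/
abbrev L2 (n : ℕ) : Type := Lp ℂ 2 (volume : Measure (Fin n → ℂ))

/-- `A_l`, the closed linear span in `L²(ℂⁿ)` of (the classes of) the `h_{r,s}` with `|r| = l`. -/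
def A (n : ℕ) (ν μ : ℝ) (l : ℕ) : Submodule ℂ (L2 n) :=
  (Submodule.span ℂ
    {F : L2 n | ∃ r s : Fin n → ℕ, len r = l ∧ F =ᵐ[volume] h ν μ r s}).topologicalClosure

/-- `F ∈ L²(ℂⁿ)` satisfies `Δ F = c F` in the sense of distributions: the operator `Δ` is formally
self-adjoint, so this is `⟨Δ φ, F⟩ = c ⟨φ, F⟩` for all test functions `φ ∈ C_c^∞(ℂⁿ)`.
Equivalently, `F` is in the kernel of `T* - c`, where `T` is `Δ` with domain `C_c^∞(ℂⁿ)`. -/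
def EigenEq {n : ℕ} (ν μ : ℝ) (c : ℂ) (F : L2 n) : Prop :=
  ∀ φ : (Fin n → ℂ) → ℂ, ContDiff ℝ ∞ φ → HasCompactSupport φ →
    ∫ z, conj (laplacian ν μ φ z) * F z = c * ∫ z, conj (φ z) * F z

end Magnetic

end

/-! Put a = (μ+iν)/2 and b = (μ-iν)/2, so that a + b = μ. The creation operator -∂_j + b z̄_j and
the annihilation operator ∂̄_j + a z_j (`lower`) are formal adjoints with commutator μ, and
`laplacian_eq` gives Δ = -4 ∑ a_j⁺ a_j - 2μn. A second ladder, -∂̄_j + b z_j and ∂_j + a z̄_j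
(`creation'`, `lower'`), commutes with the first and moves s instead of r. Each h_{r,s} is a joint
eigenfunction of the number operators of the two ladders, with eigenvalues μ r_j and μ s_j. This
yields the eigenvalue equation for Δ, and, since the number operators are symmetric on the span of
the h_{r,s}, also orthogonality. All these relations reduce to one variable, because h_{r,s} is a
product of functions u(z_j).

Completeness: the span of the h_{r,s} is stable under multiplication by z_j and z̄_j, hence under
every real linear functional L. If F is orthogonal to the span, then all moments ∫ L^k conj(g) F
vanish for the Gaussian g = h_{0,0}. Summing the exponential series, which Gaussian decay permits,
shows that the Fourier transform of conj(g) F is zero, so F = 0 (`ae_eq_zero_of_orthogonal_h`).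

Eigenspaces: A_l lies in the distributional eigenspace, as that is closed. Conversely, a cutoff
argument (`EigenEq.integral_hspan`) allows the weak equation to be tested against h_{r,s}. Hence a
weak eigenvector for c is orthogonal to every h_{r,s} whose own eigenvalue is not c. With
completeness, this determines the eigenvalues and shows that each eigenspace is exactly A_l. -/

noncomputable section

namespace Magnetic

/-! ### Wirtinger calculus. -/

section Calculus

variable {E : Type*} [NormedAddCommGroup E] [NormedSpace ℂ E] {f g : E → ℂ} {v w z : E}

theorem dz_add (hf : DifferentiableAt ℝ f z) (hg : DifferentiableAt ℝ g z) :
    dz v (fun x => f x + g x) z = dz v f z + dz v g z := by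
  simp only [dz, fderiv_fun_add hf hg, add_apply]; ring

theorem dzbar_add (hf : DifferentiableAt ℝ f z) (hg : DifferentiableAt ℝ g z) :
    dzbar v (fun x => f x + g x) z = dzbar v f z + dzbar v g z := by
  simp only [dzbar, fderiv_fun_add hf hg, add_apply]; ring

theorem dz_neg : dz v (fun x => -f x) z = -dz v f z := by
  simp only [dz, fderiv_fun_neg, neg_apply]; ring

theorem dzbar_neg : dzbar v (fun x => -f x) z = -dzbar v f z := by
  simp only [dzbar, fderiv_fun_neg, neg_apply]; ring

theorem dz_mul (hf : DifferentiableAt ℝ f z) (hg : DifferentiableAt ℝ g z) :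
    dz v (fun x => f x * g x) z = dz v f z * g z + f z * dz v g z := by
  simp only [dz, fderiv_fun_mul hf hg, add_apply, smul_apply, smul_eq_mul]
  ring

theorem dzbar_mul (hf : DifferentiableAt ℝ f z) (hg : DifferentiableAt ℝ g z) :
    dzbar v (fun x => f x * g x) z = dzbar v f z * g z + f z * dzbar v g z := by
  simp only [dzbar, fderiv_fun_mul hf hg, add_apply, smul_apply, smul_eq_mul]
  ring

theorem dz_const (c : ℂ) : dz v (fun _ : E => c) z = 0 := by simp [dz]

theorem dzbar_const (c : ℂ) : dzbar v (fun _ : E => c) z = 0 := by simp [dzbar]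

theorem dz_const_mul (c : ℂ) (hf : DifferentiableAt ℝ f z) :
    dz v (fun x => c * f x) z = c * dz v f z := by
  rw [dz_mul (differentiableAt_const c) hf, dz_const]; ring

theorem dzbar_const_mul (c : ℂ) (hf : DifferentiableAt ℝ f z) :
    dzbar v (fun x => c * f x) z = c * dzbar v f z := by
  rw [dzbar_mul (differentiableAt_const c) hf, dzbar_const]; ring

theorem dz_cexp (hf : DifferentiableAt ℝ f z) :
    dz v (fun x => Complex.exp (f x)) z = dz v f z * Complex.exp (f z) := by
  simp only [dz, hf.hasFDerivAt.cexp.fderiv, smul_apply, smul_eq_mul]; ring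

theorem dzbar_cexp (hf : DifferentiableAt ℝ f z) :
    dzbar v (fun x => Complex.exp (f x)) z = dzbar v f z * Complex.exp (f z) := by
  simp only [dzbar, hf.hasFDerivAt.cexp.fderiv, smul_apply, smul_eq_mul]; ring

theorem dz_clm (L : E →L[ℂ] ℂ) : dz v L z = L v := by
  have : fderiv ℝ L z = L.restrictScalars ℝ := (L.restrictScalars ℝ).fderiv
  simp only [dz, this, ContinuousLinearMap.coe_restrictScalars', map_smul, smul_eq_mul]
  linear_combination (-(1 / 2) * L v) * Complex.I_mul_I

theorem fderiv_conj (hf : DifferentiableAt ℝ f z) :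
    fderiv ℝ (fun x => conj (f x)) z v = conj (fderiv ℝ f z v) := by
  have := (Complex.conjCLE.toContinuousLinearMap.hasFDerivAt.comp z hf.hasFDerivAt).fderiv
  have h2 : (fun x => conj (f x)) = (⇑Complex.conjCLE.toContinuousLinearMap ∘ f) := by
    ext x; simp
  rw [h2, this]; simp

theorem dz_conj (hf : DifferentiableAt ℝ f z) :
    dz v (fun x => conj (f x)) z = conj (dzbar v f z) := by
  simp only [dz, dzbar, fderiv_conj hf, map_mul, map_add, map_div₀, map_one, map_ofNat,
    Complex.conj_I]
  ring

theorem dzbar_conj (hf : DifferentiableAt ℝ f z) :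
    dzbar v (fun x => conj (f x)) z = conj (dz v f z) := by
  simp only [dz, dzbar, fderiv_conj hf, map_mul, map_sub, map_div₀, map_one, map_ofNat,
    Complex.conj_I]
  ring

theorem contDiff_fderiv_apply (hf : ContDiff ℝ ∞ f) (v : E) :
    ContDiff ℝ ∞ (fun z => fderiv ℝ f z v) :=
  (hf.fderiv_right (m := ∞) (by simp)).clm_apply contDiff_const

theorem contDiff_dz (hf : ContDiff ℝ ∞ f) : ContDiff ℝ ∞ (dz v f) :=
  contDiff_const.mul ((contDiff_fderiv_apply hf v).sub
    (contDiff_const.mul (contDiff_fderiv_apply hf _)))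

theorem contDiff_dzbar (hf : ContDiff ℝ ∞ f) : ContDiff ℝ ∞ (dzbar v f) :=
  contDiff_const.mul ((contDiff_fderiv_apply hf v).add
    (contDiff_const.mul (contDiff_fderiv_apply hf _)))

theorem contDiff_conj (hf : ContDiff ℝ ∞ f) : ContDiff ℝ ∞ (fun z => conj (f z)) :=
  Complex.conjCLE.contDiff.comp hf

theorem _root_.ContDiff.differentiableAt_real (hf : ContDiff ℝ ∞ f) : DifferentiableAt ℝ f z :=
  hf.differentiable (by simp) z

theorem fderiv_fderiv_apply (hf : ContDiff ℝ ∞ f) (v w : E) :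
    fderiv ℝ (fun z => fderiv ℝ f z v) z w = fderiv ℝ (fderiv ℝ f) z w v := by
  have h1 : DifferentiableAt ℝ (fderiv ℝ f) z :=
    (hf.fderiv_right (m := ∞) (by simp)).differentiable (by simp) z
  rw [fderiv_clm_apply h1 (differentiableAt_const v)]
  simp

theorem dz_dzbar_comm (hf : ContDiff ℝ ∞ f) : dz v (dzbar w f) = dzbar w (dz v f) := by
  ext z
  -- Symmetry of the real second derivative is the whole content; the remainder expands both sides.
  have hs : ∀ a b, fderiv ℝ (fderiv ℝ f) z a b = fderiv ℝ (fderiv ℝ f) z b a :=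
    (hf.contDiffAt (x := z)).isSymmSndFDerivAt
      (by rw [minSmoothness_of_isRCLikeNormedField]; exact ENat.LEInfty.out)
  have d : ∀ a, DifferentiableAt ℝ (fun z => fderiv ℝ f z a) z :=
    fun a => (contDiff_fderiv_apply hf a).differentiable (by simp) z
  have d2 : ∀ a, DifferentiableAt ℝ (fun z => Complex.I * fderiv ℝ f z a) z :=
    fun a => (d a).const_mul _
  have k1 : ∀ b, fderiv ℝ (dzbar w f) z b = (1 / 2 : ℂ) * (fderiv ℝ (fderiv ℝ f) z b w
      + Complex.I * fderiv ℝ (fderiv ℝ f) z b (Complex.I • w)) := by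
    intro b
    unfold dzbar
    rw [fderiv_const_mul ((d _).fun_add (d2 _)), smul_apply, fderiv_fun_add (d _) (d2 _),
      add_apply, fderiv_const_mul (d _), smul_apply, fderiv_fderiv_apply hf,
      fderiv_fderiv_apply hf]
    simp
  have k2 : ∀ b, fderiv ℝ (dz v f) z b = (1 / 2 : ℂ) * (fderiv ℝ (fderiv ℝ f) z b v
      - Complex.I * fderiv ℝ (fderiv ℝ f) z b (Complex.I • v)) := by
    intro b
    unfold dz
    rw [fderiv_const_mul ((d _).fun_sub (d2 _)), smul_apply, fderiv_fun_sub (d _) (d2 _),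
      sub_apply, fderiv_const_mul (d _), smul_apply, fderiv_fderiv_apply hf,
      fderiv_fderiv_apply hf]
    simp
  simp only [dz.eq_1 v (dzbar w f), dzbar.eq_1 w (dz v f), k1, k2]
  rw [hs v w, hs v (Complex.I • w), hs (Complex.I • v) w, hs (Complex.I • v) (Complex.I • w)]
  ring

end Calculus

/-! ### Ladder relations in one variable. -/

section OneVariable

theorem fderiv_real_of_hasDerivAt {f : ℂ → ℂ} {f' z : ℂ} (hf : HasDerivAt f f' z) (v : ℂ) :
    fderiv ℝ f z v = v * f' := by
  rw [(hf.hasFDerivAt.restrictScalars ℝ).fderiv]; simp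

theorem dz_of_hasDerivAt {f : ℂ → ℂ} {f' z : ℂ} (hf : HasDerivAt f f' z) : dz 1 f z = f' := by
  simp only [dz, fderiv_real_of_hasDerivAt hf, smul_eq_mul]
  linear_combination (-(1 / 2) * f') * Complex.I_mul_I

theorem dzbar_of_hasDerivAt {f : ℂ → ℂ} {f' z : ℂ} (hf : HasDerivAt f f' z) :
    dzbar 1 f z = 0 := by
  simp only [dzbar, fderiv_real_of_hasDerivAt hf, smul_eq_mul]
  linear_combination ((1 / 2) * f') * Complex.I_mul_I

theorem contDiff_conj_id : ContDiff ℝ ∞ (fun ξ : ℂ => conj ξ) := contDiff_conj contDiff_id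

theorem dz_conj_id (ξ : ℂ) : dz 1 (fun ξ : ℂ => conj ξ) ξ = 0 := by
  rw [dz_conj (f := fun x => x) differentiableAt_id, dzbar_of_hasDerivAt (hasDerivAt_id' ξ)]
  simp

theorem dzbar_conj_id (ξ : ℂ) : dzbar 1 (fun ξ : ℂ => conj ξ) ξ = 1 := by
  rw [dzbar_conj (f := fun x => x) differentiableAt_id, dz_of_hasDerivAt (hasDerivAt_id' ξ)]
  simp

/-- The Gaussian `exp(b|ξ|²)` on `ℂ`. -/
def gauss (b : ℂ) : ℂ → ℂ := fun ξ => Complex.exp (b * ((‖ξ‖ ^ 2 : ℝ) : ℂ))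

theorem gauss_eq (b : ℂ) : gauss b = fun ξ => Complex.exp (b * (ξ * conj ξ)) := by
  ext ξ; rw [gauss, Complex.mul_conj']; push_cast; rfl

theorem gauss_mul (b c ξ : ℂ) : gauss b ξ * gauss c ξ = gauss (b + c) ξ := by
  rw [gauss, gauss, gauss, ← Complex.exp_add, add_mul]

theorem gauss_ne_zero (b ξ : ℂ) : gauss b ξ ≠ 0 := Complex.exp_ne_zero _

theorem contDiff_mul_conj : ContDiff ℝ ∞ (fun ξ : ℂ => ξ * conj ξ) :=
  contDiff_fun_id.mul contDiff_conj_id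

theorem contDiff_gauss (b : ℂ) : ContDiff ℝ ∞ (gauss b) := by
  rw [gauss_eq]; exact (contDiff_const.mul contDiff_mul_conj).cexp

theorem dz_gauss (b ξ : ℂ) : dz 1 (gauss b) ξ = b * conj ξ * gauss b ξ := by
  rw [gauss_eq, dz_cexp (contDiff_const.mul contDiff_mul_conj).differentiableAt_real,
    dz_const_mul _ contDiff_mul_conj.differentiableAt_real,
    dz_mul differentiableAt_fun_id contDiff_conj_id.differentiableAt_real, dz_conj_id,
    dz_of_hasDerivAt (hasDerivAt_id' ξ)]
  ring

theorem dzbar_gauss (b ξ : ℂ) : dzbar 1 (gauss b) ξ = b * ξ * gauss b ξ := by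
  rw [gauss_eq, dzbar_cexp (contDiff_const.mul contDiff_mul_conj).differentiableAt_real,
    dzbar_const_mul _ contDiff_mul_conj.differentiableAt_real,
    dzbar_mul differentiableAt_fun_id contDiff_conj_id.differentiableAt_real, dzbar_conj_id,
    dzbar_of_hasDerivAt (hasDerivAt_id' ξ)]
  ring

/-- The one-variable creation operator `-∂ + b ξ̄`. -/
def raise (b : ℂ) (f : ℂ → ℂ) : ℂ → ℂ := fun ξ => -dz 1 f ξ + b * conj ξ * f ξ

theorem contDiff_raise (b : ℂ) {f : ℂ → ℂ} (hf : ContDiff ℝ ∞ f) : ContDiff ℝ ∞ (raise b f) :=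
  (contDiff_dz hf).neg.add ((contDiff_const.mul contDiff_conj_id).mul hf)

theorem contDiff_raise_iterate (b : ℂ) {f : ℂ → ℂ} (hf : ContDiff ℝ ∞ f) (m : ℕ) :
    ContDiff ℝ ∞ ((raise b)^[m] f) := by
  induction m with
  | zero => exact hf
  | succ m ih => rw [Function.iterate_succ_apply']; exact contDiff_raise b ih

/-- The one-variable functions `(-∂ + b ξ̄)^m (ξ^k exp(-a|ξ|²))`. -/
def u (a b : ℂ) (m k : ℕ) : ℂ → ℂ := (raise b)^[m] (fun ξ => ξ ^ k * gauss (-a) ξ)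

theorem contDiff_pow_gauss (a : ℂ) (k : ℕ) : ContDiff ℝ ∞ (fun ξ => ξ ^ k * gauss (-a) ξ) :=
  (contDiff_fun_id.pow k).mul (contDiff_gauss _)

theorem contDiff_u (a b : ℂ) (m k : ℕ) : ContDiff ℝ ∞ (u a b m k) :=
  contDiff_raise_iterate b (contDiff_pow_gauss a k) m

theorem raise_u (a b : ℂ) (m k : ℕ) : raise b (u a b m k) = u a b (m + 1) k := by
  rw [u, u, Function.iterate_succ_apply']

theorem u_succ_apply (a b : ℂ) (m k : ℕ) (ξ : ℂ) :
    u a b (m + 1) k ξ = -dz 1 (u a b m k) ξ + b * conj ξ * u a b m k ξ := by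
  rw [← raise_u]; rfl

theorem dz_id_mul {f : ℂ → ℂ} (hf : ContDiff ℝ ∞ f) (ξ : ℂ) :
    dz 1 (fun ξ => ξ * f ξ) ξ = f ξ + ξ * dz 1 f ξ := by
  rw [dz_mul differentiableAt_fun_id hf.differentiableAt_real, dz_of_hasDerivAt (hasDerivAt_id' ξ)]
  ring

theorem dz_conj_mul {f : ℂ → ℂ} (hf : ContDiff ℝ ∞ f) (c ξ : ℂ) :
    dz 1 (fun ξ => c * conj ξ * f ξ) ξ = c * conj ξ * dz 1 f ξ := by
  rw [dz_mul (contDiff_const.mul contDiff_conj_id).differentiableAt_real hf.differentiableAt_real,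
    dz_const_mul _ contDiff_conj_id.differentiableAt_real, dz_conj_id]
  ring

theorem dzbar_conj_mul {f : ℂ → ℂ} (hf : ContDiff ℝ ∞ f) (c ξ : ℂ) :
    dzbar 1 (fun ξ => c * conj ξ * f ξ) ξ = c * f ξ + c * conj ξ * dzbar 1 f ξ := by
  rw [dzbar_mul (contDiff_const.mul contDiff_conj_id).differentiableAt_real
    hf.differentiableAt_real, dzbar_const_mul _ contDiff_conj_id.differentiableAt_real,
    dzbar_conj_id]
  ring

/-- Multiplication by ξ and `raise b` have commutator 1, so moving ξ past m raising operators costs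
m copies of the (m-1)-st power. -/
theorem id_mul_u (a b : ℂ) (m k : ℕ) (ξ : ℂ) :
    ξ * u a b m k ξ = u a b m (k + 1) ξ + m * u a b (m - 1) k ξ := by
  induction m generalizing ξ with
  | zero => simp [u]; ring
  | succ m ih =>
    -- The induction hypothesis is an identity of functions, hence can be differentiated.
    have key : dz 1 (fun ξ => ξ * u a b m k ξ) ξ
        = dz 1 (u a b m (k + 1)) ξ + m * dz 1 (u a b (m - 1) k) ξ := by
      rw [funext ih, dz_add (contDiff_u ..).differentiableAt_real
        (contDiff_const.mul (contDiff_u ..)).differentiableAt_real,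
        dz_const_mul _ (contDiff_u ..).differentiableAt_real]
    rw [dz_id_mul (contDiff_u ..)] at key
    -- The factor m is kept because at m = 0 the truncated index `m - 1` breaks the raising
    -- relation.
    have hm : (m : ℂ) * u a b m k ξ =
        m * (-dz 1 (u a b (m - 1) k) ξ + b * conj ξ * u a b (m - 1) k ξ) := by
      cases m with
      | zero => simp
      | succ m => rw [u_succ_apply]; simp
    rw [u_succ_apply, u_succ_apply]
    push_cast [Nat.add_sub_cancel]
    linear_combination b * conj ξ * ih ξ - key - hm

/-- ∂ + a ξ̄ commutes with `raise b`, and it sends ξ^k exp(-a|ξ|²) to k ξ^(k-1) exp(-a|ξ|²). -/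
theorem dz_u_add (a b : ℂ) (m k : ℕ) (ξ : ℂ) :
    dz 1 (u a b m k) ξ + a * conj ξ * u a b m k ξ = k * u a b m (k - 1) ξ := by
  induction m generalizing ξ with
  | zero =>
    simp only [u, Function.iterate_zero, id]
    rw [dz_mul (differentiableAt_fun_id.fun_pow k) (contDiff_gauss _).differentiableAt_real,
      dz_of_hasDerivAt (hasDerivAt_pow k ξ), dz_gauss]
    ring
  | succ m ih =>
    have key : dz 1 (fun ξ => dz 1 (u a b m k) ξ + a * conj ξ * u a b m k ξ) ξ
        = k * dz 1 (u a b m (k - 1)) ξ := by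
      rw [funext ih, dz_const_mul _ (contDiff_u ..).differentiableAt_real]
    rw [dz_add (contDiff_dz (contDiff_u ..)).differentiableAt_real
      ((contDiff_const.mul contDiff_conj_id).mul (contDiff_u ..)).differentiableAt_real,
      dz_conj_mul (contDiff_u ..)] at key
    have h1 : dz 1 (u a b (m + 1) k) ξ
        = -dz 1 (dz 1 (u a b m k)) ξ + b * conj ξ * dz 1 (u a b m k) ξ := by
      rw [← raise_u]
      unfold raise
      rw [dz_add (contDiff_dz (contDiff_u ..)).neg.differentiableAt_real
        ((contDiff_const.mul contDiff_conj_id).mul (contDiff_u ..)).differentiableAt_real,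
        dz_conj_mul (contDiff_u ..), dz_neg]
    rw [h1, u_succ_apply, u_succ_apply]
    linear_combination b * conj ξ * ih ξ - key

/-- ∂̄ + a ξ annihilates ξ^k exp(-a|ξ|²), and its commutator with `raise b` is the constant a + b;
each of the m raising operators contributes one such constant. -/
theorem dzbar_u_add (a b : ℂ) (m k : ℕ) (ξ : ℂ) :
    dzbar 1 (u a b m k) ξ + a * ξ * u a b m k ξ = (a + b) * m * u a b (m - 1) k ξ := by
  induction m generalizing ξ with
  | zero =>
    simp only [u, Function.iterate_zero, id]
    rw [dzbar_mul (differentiableAt_fun_id.fun_pow k) (contDiff_gauss _).differentiableAt_real,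
      dzbar_of_hasDerivAt (hasDerivAt_pow k ξ), dzbar_gauss]
    simp; ring
  | succ m ih =>
    have hU := contDiff_u a b m k
    have key : dz 1 (fun ξ => dzbar 1 (u a b m k) ξ + a * (ξ * u a b m k ξ)) ξ
        = (a + b) * m * dz 1 (u a b (m - 1) k) ξ := by
      have : (fun ξ => dzbar 1 (u a b m k) ξ + a * (ξ * u a b m k ξ))
          = fun ξ => (a + b) * m * u a b (m - 1) k ξ := by
        ext ξ; rw [← ih]; ring
      rw [this, dz_const_mul _ (contDiff_u ..).differentiableAt_real]
    rw [dz_add (contDiff_dzbar hU).differentiableAt_real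
      (contDiff_const.mul (contDiff_fun_id.mul hU)).differentiableAt_real,
      dz_const_mul _ (contDiff_fun_id.mul hU).differentiableAt_real, dz_id_mul hU,
      dz_dzbar_comm hU] at key
    have h1 : dzbar 1 (u a b (m + 1) k) ξ
        = -dzbar 1 (dz 1 (u a b m k)) ξ + (b * u a b m k ξ
          + b * conj ξ * dzbar 1 (u a b m k) ξ) := by
      rw [← raise_u]
      unfold raise
      rw [dzbar_add (contDiff_dz hU).neg.differentiableAt_real
        ((contDiff_const.mul contDiff_conj_id).mul hU).differentiableAt_real,
        dzbar_conj_mul hU, dzbar_neg]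
    have hm : (m : ℂ) * u a b m k ξ =
        m * (-dz 1 (u a b (m - 1) k) ξ + b * conj ξ * u a b (m - 1) k ξ) := by
      cases m with
      | zero => simp
      | succ m => rw [u_succ_apply]; simp
    rw [h1, u_succ_apply]
    push_cast [Nat.add_sub_cancel]
    linear_combination b * conj ξ * ih ξ - key - (a + b) * hm

/-- The operators -∂ + b ξ̄ and ∂ + a ξ̄ add up to multiplication by (a + b) ξ̄. -/
theorem conj_mul_u (a b : ℂ) (m k : ℕ) (ξ : ℂ) :
    (a + b) * (conj ξ * u a b m k ξ) = u a b (m + 1) k ξ + k * u a b m (k - 1) ξ := by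
  rw [u_succ_apply, ← dz_u_add]; ring

/-- If the (m+1)-st function vanished, lowering it would give (a+b)(m+1) times the m-th, which is
not zero by induction. -/
theorem u_ne_zero {a b : ℂ} (hab : a + b ≠ 0) (m k : ℕ) : ∃ ξ, u a b m k ξ ≠ 0 := by
  induction m with
  | zero => exact ⟨1, by simp [u, gauss_ne_zero]⟩
  | succ m ih =>
    by_contra! H
    obtain ⟨ξ, hξ⟩ := ih
    have h0 : u a b (m + 1) k = fun _ => 0 := funext H
    have := dzbar_u_add a b (m + 1) k ξ
    rw [h0, dzbar_const] at this
    have h1 : (m : ℂ) + 1 ≠ 0 := Nat.cast_add_one_ne_zero m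
    simp [hab, hξ, h1] at this

theorem dzbar_iterate_gauss (b : ℂ) (k : ℕ) :
    (dzbar 1)^[k] (gauss b) = fun ξ => b ^ k * (ξ ^ k * gauss b ξ) := by
  induction k with
  | zero => ext; simp
  | succ k ih =>
    ext ξ
    rw [Function.iterate_succ_apply', ih,
      dzbar_const_mul _ ((contDiff_fun_id.pow k).mul (contDiff_gauss _)).differentiableAt_real,
      dzbar_mul (differentiableAt_fun_id.fun_pow k) (contDiff_gauss _).differentiableAt_real,
      dzbar_of_hasDerivAt (hasDerivAt_pow k ξ), dzbar_gauss]
    ring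

theorem contDiff_dz_iterate {f : ℂ → ℂ} (hf : ContDiff ℝ ∞ f) (m : ℕ) :
    ContDiff ℝ ∞ ((dz 1)^[m] f) := by
  induction m with
  | zero => exact hf
  | succ m ih => rw [Function.iterate_succ_apply']; exact contDiff_dz ih

theorem dz_iterate_const_mul (c : ℂ) {f : ℂ → ℂ} (hf : ContDiff ℝ ∞ f) (m : ℕ) :
    (dz 1)^[m] (fun ξ => c * f ξ) = fun ξ => c * (dz 1)^[m] f ξ := by
  induction m with
  | zero => rfl
  | succ m ih =>
    ext ξ
    rw [Function.iterate_succ_apply', ih, Function.iterate_succ_apply',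
      dz_const_mul _ (contDiff_dz_iterate hf m).differentiableAt_real]

/-- -∂ + b ξ̄ is -∂ conjugated by exp(b|ξ|²), so its powers are conjugated powers of -∂. -/
theorem u_eq_dz_iterate (a b : ℂ) (m k : ℕ) :
    u a b m k = fun ξ => (-1) ^ m * (gauss b ξ *
      (dz 1)^[m] (fun ξ => ξ ^ k * gauss (-(a + b)) ξ) ξ) := by
  have hf : ContDiff ℝ ∞ (fun ξ => ξ ^ k * gauss (-(a + b)) ξ) :=
    (contDiff_fun_id.pow k).mul (contDiff_gauss _)
  induction m with
  | zero =>
    ext ξ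
    have := gauss_mul b (-(a + b)) ξ
    rw [show b + -(a + b) = -a by ring] at this
    simp only [u, Function.iterate_zero, id, ← this]
    ring
  | succ m ih =>
    ext ξ
    have hg := contDiff_dz_iterate hf m
    rw [u_succ_apply, ih, dz_const_mul _ ((contDiff_gauss b).mul hg).differentiableAt_real,
      dz_mul (contDiff_gauss b).differentiableAt_real hg.differentiableAt_real, dz_gauss,
      Function.iterate_succ_apply']
    ring

/-- The inner derivative ∂̄^k contributes (-σ)^k ξ^k, whose sign cancels the (-1)^k of the
definition. The result has the shape of `u_eq_dz_iterate` with a + b = σ. -/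
theorem complexHermite_eq (σ : ℝ) (m k : ℕ) (ξ : ℂ) :
    complexHermite σ m k ξ = (-1) ^ m * (σ : ℂ) ^ k * (gauss σ ξ *
      (dz 1)^[m] (fun ξ => ξ ^ k * gauss (-(σ : ℂ)) ξ) ξ) := by
  have h1 : (fun w : ℂ => Complex.exp (-(σ : ℂ) * ((‖w‖ ^ 2 : ℝ) : ℂ))) = gauss (-(σ : ℂ)) := rfl
  rw [complexHermite, h1, dzbar_iterate_gauss, dz_iterate_const_mul _
    ((contDiff_fun_id.pow k).mul (contDiff_gauss _)), neg_pow (σ : ℂ), pow_add]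
  have h2 : ((-1 : ℂ) ^ k) * (-1) ^ k = 1 := by rw [← mul_pow]; simp
  rw [show Complex.exp ((σ : ℂ) * ((‖ξ‖ ^ 2 : ℝ) : ℂ)) = gauss σ ξ from rfl]
  linear_combination (-1) ^ m * (σ : ℂ) ^ k * gauss σ ξ *
    (dz 1)^[m] (fun ξ => ξ ^ k * gauss (-(σ : ℂ)) ξ) ξ * h2

end OneVariable

/-! ### Product structure and ladder relations on ℂⁿ. -/

section Tensor

variable {n : ℕ}

theorem contDiff_coord (j : Fin n) : ContDiff ℝ ∞ (fun z : Fin n → ℂ => z j) :=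
  (contDiff_apply ℂ ℂ j).restrict_scalars ℝ

theorem contDiff_conj_coord (j : Fin n) : ContDiff ℝ ∞ (fun z : Fin n → ℂ => conj (z j)) :=
  contDiff_conj (contDiff_coord j)

theorem dz_coord (j : Fin n) (z : Fin n → ℂ) (v : Fin n → ℂ) :
    dz v (fun z : Fin n → ℂ => z j) z = v j :=
  dz_clm (ContinuousLinearMap.proj (R := ℂ) (φ := fun _ : Fin n => ℂ) j)

/-- The product function `∏ f_i(z_i)`. -/
def tensor (f : Fin n → ℂ → ℂ) : (Fin n → ℂ) → ℂ := fun z => ∏ i, f i (z i)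

theorem tensor_eq_mul_erase (f : Fin n → ℂ → ℂ) (j : Fin n) (z : Fin n → ℂ) :
    tensor f z = f j (z j) * ∏ i ∈ Finset.univ.erase j, f i (z i) :=
  (Finset.mul_prod_erase _ _ (Finset.mem_univ j)).symm

theorem tensor_update (f : Fin n → ℂ → ℂ) (j : Fin n) (g : ℂ → ℂ) (z : Fin n → ℂ) :
    tensor (Function.update f j g) z
      = g (z j) * ∏ i ∈ Finset.univ.erase j, f i (z i) := by
  rw [tensor_eq_mul_erase _ j, Function.update_self]
  congr 1
  refine Finset.prod_congr rfl fun i hi => ?_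
  rw [Function.update_of_ne (Finset.ne_of_mem_erase hi)]

theorem contDiff_tensor {f : Fin n → ℂ → ℂ} (hf : ∀ i, ContDiff ℝ ∞ (f i)) :
    ContDiff ℝ ∞ (tensor f) :=
  contDiff_prod fun i _ => (hf i).comp (contDiff_coord i)

theorem fderiv_tensor {f : Fin n → ℂ → ℂ} (hf : ∀ i, ContDiff ℝ ∞ (f i)) (j : Fin n)
    (z : Fin n → ℂ) (c : ℂ) :
    fderiv ℝ (tensor f) z (c • e j)
      = fderiv ℝ (f j) (z j) c * ∏ i ∈ Finset.univ.erase j, f i (z i) := by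
  have h1 : ∀ i ∈ Finset.univ, HasFDerivAt (fun z : Fin n → ℂ => f i (z i))
      ((fderiv ℝ (f i) (z i)).comp
        (ContinuousLinearMap.proj (R := ℝ) (φ := fun _ : Fin n => ℂ) i)) z := fun i _ =>
    ((hf i).differentiableAt_real (z := z i)).hasFDerivAt.comp z
      (ContinuousLinearMap.proj (R := ℝ) (φ := fun _ : Fin n => ℂ) i).hasFDerivAt
  have h2 := (HasFDerivAt.finsetProd h1).fderiv
  rw [show tensor f = fun z => ∏ i, f i (z i) from rfl, h2, sum_apply,
    Finset.sum_eq_single j]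
  · simp [e]; ring
  · intro i _ hij
    simp [e, hij]
  · simp

theorem dz_tensor {f : Fin n → ℂ → ℂ} (hf : ∀ i, ContDiff ℝ ∞ (f i)) (j : Fin n)
    (z : Fin n → ℂ) :
    dz (e j) (tensor f) z = dz 1 (f j) (z j) * ∏ i ∈ Finset.univ.erase j, f i (z i) := by
  have h1 := fderiv_tensor hf j z 1
  rw [one_smul] at h1
  rw [dz, h1, fderiv_tensor hf, dz, smul_eq_mul, mul_one]
  ring

theorem dzbar_tensor {f : Fin n → ℂ → ℂ} (hf : ∀ i, ContDiff ℝ ∞ (f i)) (j : Fin n)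
    (z : Fin n → ℂ) :
    dzbar (e j) (tensor f) z
      = dzbar 1 (f j) (z j) * ∏ i ∈ Finset.univ.erase j, f i (z i) := by
  have h1 := fderiv_tensor hf j z 1
  rw [one_smul] at h1
  rw [dzbar, h1, fderiv_tensor hf, dzbar, smul_eq_mul, mul_one]
  ring

theorem creation_tensor (ν μ : ℝ) {f : Fin n → ℂ → ℂ} (hf : ∀ i, ContDiff ℝ ∞ (f i))
    (j : Fin n) :
    creation ν μ j (tensor f)
      = tensor (Function.update f j (raise (((μ : ℂ) - Complex.I * ν) / 2) (f j))) := by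
  ext z
  rw [tensor_update, creation, dz_tensor hf, tensor_eq_mul_erase f j, raise]
  ring

theorem contDiff_update {f : Fin n → ℂ → ℂ} (hf : ∀ i, ContDiff ℝ ∞ (f i)) (j : Fin n)
    {g : ℂ → ℂ} (hg : ContDiff ℝ ∞ g) (i : Fin n) : ContDiff ℝ ∞ (Function.update f j g i) := by
  rcases eq_or_ne i j with rfl | hij
  · rwa [Function.update_self]
  · rw [Function.update_of_ne hij]; exact hf i

theorem creation_iterate_tensor (ν μ : ℝ) {f : Fin n → ℂ → ℂ} (hf : ∀ i, ContDiff ℝ ∞ (f i))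
    (j : Fin n) (m : ℕ) :
    (creation ν μ j)^[m] (tensor f)
      = tensor (Function.update f j ((raise (((μ : ℂ) - Complex.I * ν) / 2))^[m] (f j))) := by
  induction m with
  | zero => simp
  | succ m ih =>
    rw [Function.iterate_succ_apply', ih,
      creation_tensor ν μ (contDiff_update hf j (contDiff_raise_iterate _ (hf j) m)),
      Function.update_idem, Function.update_self, Function.iterate_succ_apply']

theorem sqNorm_exp (c : ℂ) (z : Fin n → ℂ) :
    Complex.exp (c * (sqNorm z : ℂ)) = ∏ j, gauss c (z j) := by
  simp only [sqNorm, gauss, ← Complex.exp_sum]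
  congr 1
  push_cast
  rw [Finset.mul_sum]

theorem ground_eq_tensor (ν μ : ℝ) (s : Fin n → ℕ) :
    ground ν μ s = tensor fun i =>
      u (((μ : ℂ) + Complex.I * ν) / 2) (((μ : ℂ) - Complex.I * ν) / 2) 0 (s i) := by
  ext z
  rw [ground, sqNorm_exp, ← Finset.prod_mul_distrib]
  rfl

/-- The j-th creation operator acts on the j-th factor alone, so everything about h_{r,s} follows
from the one-variable functions. -/
theorem h_eq_tensor (ν μ : ℝ) (r s : Fin n → ℕ) :
    h ν μ r s = tensor fun i =>
      u (((μ : ℂ) + Complex.I * ν) / 2) (((μ : ℂ) - Complex.I * ν) / 2) (r i) (s i) := by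
  set a : ℂ := ((μ : ℂ) + Complex.I * ν) / 2
  set b : ℂ := ((μ : ℂ) - Complex.I * ν) / 2 with hb
  -- Induction over the part of the coordinate list already processed; without repetitions, the
  -- factor at j is still unraised when j is reached.
  have key : ∀ l : List (Fin n), l.Nodup →
      l.foldr (fun j f => (creation ν μ j)^[r j] f) (ground ν μ s)
        = tensor fun i => u a b (if i ∈ l then r i else 0) (s i) := by
    intro l
    induction l with
    | nil => intro _; simp [ground_eq_tensor, a, b]
    | cons j l ih =>
      intro hl
      rw [List.nodup_cons] at hl
      rw [List.foldr_cons, ih hl.2, creation_iterate_tensor ν μ (fun i => contDiff_u ..)]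
      congr 1
      funext i
      rcases eq_or_ne i j with rfl | hij
      · simp only [Function.update_self, if_neg hl.1, List.mem_cons, true_or, if_true]
        rfl
      · simp [hij]
  rw [h, key _ (List.nodup_finRange n)]
  simp

theorem contDiff_h (ν μ : ℝ) (r s : Fin n → ℕ) : ContDiff ℝ ∞ (h ν μ r s) := by
  rw [h_eq_tensor]; exact contDiff_tensor fun i => contDiff_u ..

theorem h_product_formula (ν : ℝ) {μ : ℝ} (hμ : μ ≠ 0) (r s : Fin n → ℕ) (z : Fin n → ℂ) :
    h ν μ r s z =
      Complex.exp (-(Complex.I * ν / 2) * (sqNorm z : ℂ)) *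
        (((μ : ℂ) ^ len s)⁻¹ *
          ∏ j, (Complex.exp (-((μ : ℂ) / 2) * ((‖z j‖ ^ 2 : ℝ) : ℂ)) *
            complexHermite μ (r j) (s j) (z j))) := by
  rw [h_eq_tensor, sqNorm_exp, len, ← Finset.prod_pow_eq_pow_sum, ← Finset.prod_inv_distrib,
    ← Finset.prod_mul_distrib, ← Finset.prod_mul_distrib]
  refine Finset.prod_congr rfl fun j _ => ?_
  have h1 : Complex.exp (-((μ : ℂ) / 2) * ((‖z j‖ ^ 2 : ℝ) : ℂ)) = gauss (-((μ : ℂ) / 2)) (z j) :=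
    rfl
  -- b = -iν/2 - μ/2 + μ separates the phase, the factor exp(-μ|z|²/2) and the weight built into
  -- `complexHermite`.
  have h2 : gauss (((μ : ℂ) - Complex.I * ν) / 2) (z j)
      = gauss (-(Complex.I * ν / 2)) (z j) * (gauss (-((μ : ℂ) / 2)) (z j) * gauss μ (z j)) := by
    rw [gauss_mul, gauss_mul]; congr 1; ring
  have hμ' : (μ : ℂ) ≠ 0 := mod_cast hμ
  beta_reduce
  rw [u_eq_dz_iterate, complexHermite_eq, h1,
    show ((μ : ℂ) + Complex.I * ν) / 2 + ((μ : ℂ) - Complex.I * ν) / 2 = μ by ring]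
  beta_reduce
  rw [h2]
  field_simp

theorem h_update_left (ν μ : ℝ) (r s : Fin n → ℕ) (j : Fin n) (m : ℕ) (z : Fin n → ℂ) :
    h ν μ (Function.update r j m) s z =
      u (((μ : ℂ) + Complex.I * ν) / 2) (((μ : ℂ) - Complex.I * ν) / 2) m (s j) (z j) *
        ∏ i ∈ Finset.univ.erase j,
          u (((μ : ℂ) + Complex.I * ν) / 2) (((μ : ℂ) - Complex.I * ν) / 2) (r i) (s i) (z i) := by
  rw [h_eq_tensor, tensor_eq_mul_erase _ j, Function.update_self]
  congr 1
  refine Finset.prod_congr rfl fun i hi => ?_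
  rw [Function.update_of_ne (Finset.ne_of_mem_erase hi)]

theorem h_update_right (ν μ : ℝ) (r s : Fin n → ℕ) (j : Fin n) (k : ℕ) (z : Fin n → ℂ) :
    h ν μ r (Function.update s j k) z =
      u (((μ : ℂ) + Complex.I * ν) / 2) (((μ : ℂ) - Complex.I * ν) / 2) (r j) k (z j) *
        ∏ i ∈ Finset.univ.erase j,
          u (((μ : ℂ) + Complex.I * ν) / 2) (((μ : ℂ) - Complex.I * ν) / 2) (r i) (s i) (z i) := by
  rw [h_eq_tensor, tensor_eq_mul_erase _ j, Function.update_self]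
  congr 1
  refine Finset.prod_congr rfl fun i hi => ?_
  rw [Function.update_of_ne (Finset.ne_of_mem_erase hi)]

theorem h_eq_mul_erase (ν μ : ℝ) (r s : Fin n → ℕ) (j : Fin n) (z : Fin n → ℂ) :
    h ν μ r s z =
      u (((μ : ℂ) + Complex.I * ν) / 2) (((μ : ℂ) - Complex.I * ν) / 2) (r j) (s j) (z j) *
        ∏ i ∈ Finset.univ.erase j,
          u (((μ : ℂ) + Complex.I * ν) / 2) (((μ : ℂ) - Complex.I * ν) / 2) (r i) (s i) (z i) := by
  rw [h_eq_tensor, tensor_eq_mul_erase _ j]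

/-- The annihilation operator `∂/∂z̄_j + ((μ+iν)/2) z_j`. -/
def lower (ν μ : ℝ) (j : Fin n) (f : (Fin n → ℂ) → ℂ) : (Fin n → ℂ) → ℂ :=
  fun z => dzbar (e j) f z + ((μ : ℂ) + Complex.I * ν) / 2 * z j * f z

/-- The dual creation operator `-∂/∂z̄_j + ((μ-iν)/2) z_j`. -/
def creation' (ν μ : ℝ) (j : Fin n) (f : (Fin n → ℂ) → ℂ) : (Fin n → ℂ) → ℂ :=
  fun z => -dzbar (e j) f z + ((μ : ℂ) - Complex.I * ν) / 2 * z j * f z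

/-- The dual annihilation operator `∂/∂z_j + ((μ+iν)/2) z̄_j`. -/
def lower' (ν μ : ℝ) (j : Fin n) (f : (Fin n → ℂ) → ℂ) : (Fin n → ℂ) → ℂ :=
  fun z => dz (e j) f z + ((μ : ℂ) + Complex.I * ν) / 2 * conj (z j) * f z

theorem creation_h (ν μ : ℝ) (r s : Fin n → ℕ) (j : Fin n) :
    creation ν μ j (h ν μ r s) = h ν μ (Function.update r j (r j + 1)) s := by
  ext z
  rw [h_update_left, h_eq_tensor, creation_tensor ν μ (fun i => contDiff_u ..), tensor_update,
    raise_u]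

theorem lower_h (ν μ : ℝ) (r s : Fin n → ℕ) (j : Fin n) :
    lower ν μ j (h ν μ r s) = fun z => μ * r j * h ν μ (Function.update r j (r j - 1)) s z := by
  ext z
  have key := dzbar_u_add (((μ : ℂ) + Complex.I * ν) / 2) (((μ : ℂ) - Complex.I * ν) / 2)
    (r j) (s j) (z j)
  rw [h_update_left, lower, h_eq_mul_erase ν μ r s j z]
  rw [h_eq_tensor, dzbar_tensor (fun i => contDiff_u ..)]
  linear_combination (∏ i ∈ Finset.univ.erase j,
    u (((μ : ℂ) + Complex.I * ν) / 2) (((μ : ℂ) - Complex.I * ν) / 2) (r i) (s i) (z i)) * key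

theorem lower'_h (ν μ : ℝ) (r s : Fin n → ℕ) (j : Fin n) :
    lower' ν μ j (h ν μ r s) = fun z => s j * h ν μ r (Function.update s j (s j - 1)) z := by
  ext z
  have key := dz_u_add (((μ : ℂ) + Complex.I * ν) / 2) (((μ : ℂ) - Complex.I * ν) / 2)
    (r j) (s j) (z j)
  rw [h_update_right, lower', h_eq_mul_erase ν μ r s j z]
  rw [h_eq_tensor, dz_tensor (fun i => contDiff_u ..)]
  linear_combination (∏ i ∈ Finset.univ.erase j,
    u (((μ : ℂ) + Complex.I * ν) / 2) (((μ : ℂ) - Complex.I * ν) / 2) (r i) (s i) (z i)) * key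

theorem coord_mul_h (ν μ : ℝ) (r s : Fin n → ℕ) (j : Fin n) (z : Fin n → ℂ) :
    z j * h ν μ r s z = h ν μ r (Function.update s j (s j + 1)) z
      + r j * h ν μ (Function.update r j (r j - 1)) s z := by
  have key := id_mul_u (((μ : ℂ) + Complex.I * ν) / 2) (((μ : ℂ) - Complex.I * ν) / 2)
    (r j) (s j) (z j)
  rw [h_update_left, h_update_right, h_eq_mul_erase ν μ r s j z]
  linear_combination (∏ i ∈ Finset.univ.erase j,
    u (((μ : ℂ) + Complex.I * ν) / 2) (((μ : ℂ) - Complex.I * ν) / 2) (r i) (s i) (z i)) * key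

theorem conj_coord_mul_h (ν μ : ℝ) (r s : Fin n → ℕ) (j : Fin n) (z : Fin n → ℂ) :
    μ * (conj (z j) * h ν μ r s z) = h ν μ (Function.update r j (r j + 1)) s z
      + s j * h ν μ r (Function.update s j (s j - 1)) z := by
  have key := conj_mul_u (((μ : ℂ) + Complex.I * ν) / 2) (((μ : ℂ) - Complex.I * ν) / 2)
    (r j) (s j) (z j)
  rw [h_update_left, h_update_right, h_eq_mul_erase ν μ r s j z]
  linear_combination (∏ i ∈ Finset.univ.erase j,
    u (((μ : ℂ) + Complex.I * ν) / 2) (((μ : ℂ) - Complex.I * ν) / 2) (r i) (s i) (z i)) * key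

/-- `creation'` and `lower` add up to multiplication by μ z_j, so the formula is the difference of
`coord_mul_h` and `lower_h`. -/
theorem creation'_h (ν μ : ℝ) (r s : Fin n → ℕ) (j : Fin n) :
    creation' ν μ j (h ν μ r s) = fun z => μ * h ν μ r (Function.update s j (s j + 1)) z := by
  ext z
  have h1 := congrFun (lower_h ν μ r s j) z
  rw [lower] at h1
  have h2 := coord_mul_h ν μ r s j z
  rw [creation']
  linear_combination μ * h2 - h1

theorem creation_const_mul (ν μ : ℝ) (j : Fin n) (c : ℂ) {f : (Fin n → ℂ) → ℂ}
    (hf : ContDiff ℝ ∞ f) :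
    creation ν μ j (fun z => c * f z) = fun z => c * creation ν μ j f z := by
  ext z
  rw [creation, creation, dz_const_mul _ hf.differentiableAt_real]; ring

theorem creation'_const_mul (ν μ : ℝ) (j : Fin n) (c : ℂ) {f : (Fin n → ℂ) → ℂ}
    (hf : ContDiff ℝ ∞ f) :
    creation' ν μ j (fun z => c * f z) = fun z => c * creation' ν μ j f z := by
  ext z
  rw [creation', creation', dzbar_const_mul _ hf.differentiableAt_real]; ring

theorem creation_lower_h (ν μ : ℝ) (r s : Fin n → ℕ) (j : Fin n) :
    creation ν μ j (lower ν μ j (h ν μ r s)) = fun z => μ * r j * h ν μ r s z := by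
  ext z
  rw [lower_h, creation_const_mul _ _ _ _ (contDiff_h ..), creation_h]
  rcases Nat.eq_zero_or_pos (r j) with h0 | h0
  · simp [h0]
  · simp [Nat.sub_add_cancel h0]

theorem creation'_lower'_h (ν μ : ℝ) (r s : Fin n → ℕ) (j : Fin n) :
    creation' ν μ j (lower' ν μ j (h ν μ r s)) = fun z => μ * s j * h ν μ r s z := by
  ext z
  rw [lower'_h, creation'_const_mul _ _ _ _ (contDiff_h ..), creation'_h]
  rcases Nat.eq_zero_or_pos (s j) with h0 | h0
  · simp [h0]
  · simp only [Function.update_idem, Function.update_self, Nat.sub_add_cancel h0,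
      Function.update_eq_self]
    ring

/-- Expanding the product, the coefficient of |z|² is ab = (ν²+μ²)/4, and the derivative falling on
a z_j leaves -a for each j. Over all j these give 4an = 2μn + 2iνn, of which only 2iνn belongs to Δ;
hence the correction -2μn. -/
theorem laplacian_eq (ν μ : ℝ) {f : (Fin n → ℂ) → ℂ} (hf : ContDiff ℝ ∞ f) (z : Fin n → ℂ) :
    laplacian ν μ f z =
      -4 * ∑ j, creation ν μ j (lower ν μ j f) z - 2 * μ * n * f z := by
  have key : ∀ j, creation ν μ j (lower ν μ j f) z =
      -dz (e j) (dzbar (e j) f) z - ((μ : ℂ) + Complex.I * ν) / 2 * f z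
        - ((μ : ℂ) + Complex.I * ν) / 2 * (z j * dz (e j) f z)
        + ((μ : ℂ) - Complex.I * ν) / 2 * (conj (z j) * dzbar (e j) f z)
        + ((ν : ℂ) ^ 2 + (μ : ℂ) ^ 2) / 4 * (((‖z j‖ ^ 2 : ℝ) : ℂ) * f z) := by
    intro j
    have h1 : dz (e j) (lower ν μ j f) z = dz (e j) (dzbar (e j) f) z
        + (((μ : ℂ) + Complex.I * ν) / 2 * f z
          + ((μ : ℂ) + Complex.I * ν) / 2 * z j * dz (e j) f z) := by
      unfold lower
      rw [dz_add (contDiff_dzbar hf).differentiableAt_real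
        ((contDiff_const.mul (contDiff_coord j)).mul hf).differentiableAt_real,
        dz_mul (contDiff_const.mul (contDiff_coord j)).differentiableAt_real
          hf.differentiableAt_real,
        dz_const_mul _ (contDiff_coord j).differentiableAt_real, dz_coord]
      simp [e]
    have h2 : ((‖z j‖ ^ 2 : ℝ) : ℂ) = z j * conj (z j) := by
      rw [Complex.mul_conj']; push_cast; rfl
    rw [creation, h1, lower, h2]
    linear_combination -(1 / 4) * (ν : ℂ) ^ 2 * z j * conj (z j) * f z * Complex.I_sq
  rw [Finset.sum_congr rfl fun j _ => key j, laplacian]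
  simp only [Finset.sum_add_distrib, Finset.sum_sub_distrib, Finset.sum_neg_distrib,
    ← Finset.mul_sum, Finset.sum_const, Finset.card_univ, Fintype.card_fin, nsmul_eq_mul,
    ← Finset.sum_mul, sqNorm]
  push_cast
  ring

theorem laplacian_h (ν μ : ℝ) (r s : Fin n → ℕ) (z : Fin n → ℂ) :
    laplacian ν μ (h ν μ r s) z =
      ((-2 * μ * (n + 2 * (len r : ℝ)) : ℝ) : ℂ) * h ν μ r s z := by
  rw [laplacian_eq ν μ (contDiff_h ..)]
  simp only [creation_lower_h, ← Finset.sum_mul, ← Finset.mul_sum, len]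
  push_cast
  ring

theorem h_ne_zero (ν : ℝ) {μ : ℝ} (hμ : μ ≠ 0) (r s : Fin n → ℕ) : h ν μ r s ≠ 0 := by
  have hμ' : (μ : ℂ) ≠ 0 := mod_cast hμ
  have hab : ((μ : ℂ) + Complex.I * ν) / 2 + ((μ : ℂ) - Complex.I * ν) / 2 ≠ 0 := by
    convert hμ' using 1; ring
  choose ξ hξ using fun i => u_ne_zero hab (r i) (s i)
  intro H
  have := congrFun H ξ
  rw [h_eq_tensor] at this
  exact Finset.prod_ne_zero_iff.2 (fun i _ => hξ i) this

end Tensor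

/-! ### Formal adjoints and integration by parts. -/

section Adjoint

variable {n : ℕ}

/-- A class of smooth functions stable under the first-order operators with linear
coefficients. -/
structure OpClosed (X : Set ((Fin n → ℂ) → ℂ)) : Prop where
  smooth : ∀ {f}, f ∈ X → ContDiff ℝ ∞ f
  add : ∀ {f g}, f ∈ X → g ∈ X → (fun z => f z + g z) ∈ X
  const_mul : ∀ (c : ℂ) {f}, f ∈ X → (fun z => c * f z) ∈ X
  coord_mul : ∀ (j : Fin n) {f}, f ∈ X → (fun z => z j * f z) ∈ X
  conj_mul : ∀ (j : Fin n) {f}, f ∈ X → (fun z => conj (z j) * f z) ∈ X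
  dz : ∀ (j : Fin n) {f}, f ∈ X → dz (e j) f ∈ X
  dzbar : ∀ (j : Fin n) {f}, f ∈ X → dzbar (e j) f ∈ X

namespace OpClosed

variable {X : Set ((Fin n → ℂ) → ℂ)} (H : OpClosed X) {f : (Fin n → ℂ) → ℂ}

include H

theorem neg (hf : f ∈ X) : (fun z => -f z) ∈ X := by
  convert H.const_mul (-1) hf using 2; ring

theorem creation (ν μ : ℝ) (j : Fin n) (hf : f ∈ X) : creation ν μ j f ∈ X := by
  convert H.add (H.neg (H.dz j hf)) (H.const_mul (((μ : ℂ) - Complex.I * ν) / 2)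
    (H.conj_mul j hf)) using 1
  ext z; simp only [Magnetic.creation]; ring

theorem lower (ν μ : ℝ) (j : Fin n) (hf : f ∈ X) : lower ν μ j f ∈ X := by
  convert H.add (H.dzbar j hf) (H.const_mul (((μ : ℂ) + Complex.I * ν) / 2)
    (H.coord_mul j hf)) using 1
  ext z; simp only [Magnetic.lower]; ring

theorem lower' (ν μ : ℝ) (j : Fin n) (hf : f ∈ X) : lower' ν μ j f ∈ X := by
  convert H.add (H.dz j hf) (H.const_mul (((μ : ℂ) + Complex.I * ν) / 2)
    (H.conj_mul j hf)) using 1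
  ext z; simp only [Magnetic.lower']; ring

theorem fderiv_e (j : Fin n) (hf : f ∈ X) : (fun z => fderiv ℝ f z (e j)) ∈ X := by
  convert H.add (H.dz j hf) (H.dzbar j hf) using 1
  ext z; simp only [Magnetic.dz, Magnetic.dzbar]; ring

theorem fderiv_I_e (j : Fin n) (hf : f ∈ X) :
    (fun z => fderiv ℝ f z (Complex.I • e j)) ∈ X := by
  convert H.const_mul Complex.I (H.add (H.dz j hf) (H.neg (H.dzbar j hf))) using 1
  ext z; simp only [Magnetic.dz, Magnetic.dzbar]
  linear_combination (fderiv ℝ f z (Complex.I • e j)) * Complex.I_sq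

end OpClosed

/-- Two classes of functions whose mutual products are integrable. -/
structure Paired (X Y : Set ((Fin n → ℂ) → ℂ)) : Prop where
  left : OpClosed X
  right : OpClosed Y
  integrable : ∀ {f g}, f ∈ X → g ∈ Y → Integrable (fun z => conj (f z) * g z)

namespace Paired

variable {X Y : Set ((Fin n → ℂ) → ℂ)} (H : Paired X Y) {f g : (Fin n → ℂ) → ℂ}
  (hf : f ∈ X) (hg : g ∈ Y)

include H hf hg

/-- No boundary terms arise because the product and both differentiated products are integrable;
`Paired` is designed to supply these three facts. -/
theorem integral_fderiv {v : Fin n → ℂ} (hfv : (fun z => fderiv ℝ f z v) ∈ X)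
    (hgv : (fun z => fderiv ℝ g z v) ∈ Y) :
    ∫ z, conj (fderiv ℝ f z v) * g z = -∫ z, conj (f z) * fderiv ℝ g z v := by
  have hF : Differentiable ℝ f := (H.left.smooth hf).differentiable (by simp)
  have hG : Differentiable ℝ g := (H.right.smooth hg).differentiable (by simp)
  have hc : ∀ z, fderiv ℝ (fun x => conj (f x)) z v = conj (fderiv ℝ f z v) :=
    fun z => fderiv_conj (hF z)
  have key := integral_mul_fderiv_eq_neg_fderiv_mul_of_integrable (μ := volume) (v := v)
    (f := fun x => conj (f x)) (g := g)
    (by simpa only [hc] using H.integrable hfv hg) (H.integrable hf hgv) (H.integrable hf hg)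
    (fun z _ => ((contDiff_conj (H.left.smooth hf)).differentiable (by simp)) z) (fun z _ => hG z)
  rw [key]; simp only [hc, neg_neg]

theorem integral_dz (j : Fin n) :
    ∫ z, conj (dz (e j) f z) * g z = -∫ z, conj (f z) * dzbar (e j) g z := by
  have h1 := H.integral_fderiv hf hg (H.left.fderiv_e j hf) (H.right.fderiv_e j hg)
  have h2 := H.integral_fderiv hf hg (H.left.fderiv_I_e j hf) (H.right.fderiv_I_e j hg)
  have i1 := H.integrable (H.left.fderiv_e j hf) hg
  have i2 := H.integrable (H.left.fderiv_I_e j hf) hg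
  have i3 := H.integrable hf (H.right.fderiv_e j hg)
  have i4 := H.integrable hf (H.right.fderiv_I_e j hg)
  have e1 : ∀ z, conj (dz (e j) f z) * g z = (1 / 2) * (conj (fderiv ℝ f z (e j)) * g z
      + Complex.I * (conj (fderiv ℝ f z (Complex.I • e j)) * g z)) := fun z => by
    simp only [dz, map_mul, map_sub, map_div₀, map_one, map_ofNat, Complex.conj_I]; ring
  have e2 : ∀ z, conj (f z) * dzbar (e j) g z = (1 / 2) * (conj (f z) * fderiv ℝ g z (e j)
      + Complex.I * (conj (f z) * fderiv ℝ g z (Complex.I • e j))) := fun z => by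
    simp only [dzbar]; ring
  simp only [e1, e2]
  rw [integral_const_mul, integral_const_mul, integral_add i1 (i2.const_mul _),
    integral_add i3 (i4.const_mul _), integral_const_mul, integral_const_mul, h1, h2]
  ring

theorem integral_dzbar (j : Fin n) :
    ∫ z, conj (dzbar (e j) f z) * g z = -∫ z, conj (f z) * dz (e j) g z := by
  have h1 := H.integral_fderiv hf hg (H.left.fderiv_e j hf) (H.right.fderiv_e j hg)
  have h2 := H.integral_fderiv hf hg (H.left.fderiv_I_e j hf) (H.right.fderiv_I_e j hg)
  have i1 := H.integrable (H.left.fderiv_e j hf) hg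
  have i2 := H.integrable (H.left.fderiv_I_e j hf) hg
  have i3 := H.integrable hf (H.right.fderiv_e j hg)
  have i4 := H.integrable hf (H.right.fderiv_I_e j hg)
  have e1 : ∀ z, conj (dzbar (e j) f z) * g z = (1 / 2) * (conj (fderiv ℝ f z (e j)) * g z
      - Complex.I * (conj (fderiv ℝ f z (Complex.I • e j)) * g z)) := fun z => by
    simp only [dzbar, map_mul, map_add, map_div₀, map_one, map_ofNat, Complex.conj_I]; ring
  have e2 : ∀ z, conj (f z) * dz (e j) g z = (1 / 2) * (conj (f z) * fderiv ℝ g z (e j)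
      - Complex.I * (conj (f z) * fderiv ℝ g z (Complex.I • e j))) := fun z => by
    simp only [dz]; ring
  simp only [e1, e2]
  rw [integral_const_mul, integral_const_mul, integral_sub i1 (i2.const_mul _),
    integral_sub i3 (i4.const_mul _), integral_const_mul, integral_const_mul, h1, h2]
  ring

theorem integral_creation (ν μ : ℝ) (j : Fin n) :
    ∫ z, conj (creation ν μ j f z) * g z = ∫ z, conj (f z) * lower ν μ j g z := by
  have e1 : ∀ z, conj (creation ν μ j f z) * g z = -(conj (dz (e j) f z) * g z)
      + ((μ : ℂ) + Complex.I * ν) / 2 * (conj (f z) * (z j * g z)) := fun z => by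
    simp only [creation, map_add, map_mul, map_neg, map_sub, map_div₀, map_ofNat, Complex.conj_I,
      Complex.conj_ofReal, Complex.conj_conj]
    ring
  have e2 : ∀ z, conj (f z) * lower ν μ j g z = conj (f z) * dzbar (e j) g z
      + ((μ : ℂ) + Complex.I * ν) / 2 * (conj (f z) * (z j * g z)) := fun z => by
    simp only [lower]; ring
  have i1 := H.integrable (H.left.dz j hf) hg
  have i2 := H.integrable hf (H.right.coord_mul j hg)
  have i3 := H.integrable hf (H.right.dzbar j hg)
  simp only [e1, e2]
  rw [integral_add i1.fun_neg (i2.const_mul _), integral_add i3 (i2.const_mul _), integral_neg,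
    H.integral_dz hf hg, neg_neg]

theorem integral_lower (ν μ : ℝ) (j : Fin n) :
    ∫ z, conj (lower ν μ j f z) * g z = ∫ z, conj (f z) * creation ν μ j g z := by
  have e1 : ∀ z, conj (lower ν μ j f z) * g z = conj (dzbar (e j) f z) * g z
      + ((μ : ℂ) - Complex.I * ν) / 2 * (conj (f z) * (conj (z j) * g z)) := fun z => by
    simp only [lower, map_add, map_mul, map_div₀, map_ofNat, Complex.conj_I,
      Complex.conj_ofReal]
    ring
  have e2 : ∀ z, conj (f z) * creation ν μ j g z = -(conj (f z) * dz (e j) g z)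
      + ((μ : ℂ) - Complex.I * ν) / 2 * (conj (f z) * (conj (z j) * g z)) := fun z => by
    simp only [creation]; ring
  have i1 := H.integrable (H.left.dzbar j hf) hg
  have i2 := H.integrable hf (H.right.conj_mul j hg)
  have i3 := H.integrable hf (H.right.dz j hg)
  simp only [e1, e2]
  rw [integral_add i1 (i2.const_mul _), integral_add i3.fun_neg (i2.const_mul _), integral_neg,
    H.integral_dzbar hf hg]

theorem integral_lower' (ν μ : ℝ) (j : Fin n) :
    ∫ z, conj (lower' ν μ j f z) * g z = ∫ z, conj (f z) * creation' ν μ j g z := by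
  have e1 : ∀ z, conj (lower' ν μ j f z) * g z = conj (dz (e j) f z) * g z
      + ((μ : ℂ) - Complex.I * ν) / 2 * (conj (f z) * (z j * g z)) := fun z => by
    simp only [lower', map_add, map_mul, map_div₀, map_ofNat, Complex.conj_I,
      Complex.conj_ofReal, Complex.conj_conj]
    ring
  have e2 : ∀ z, conj (f z) * creation' ν μ j g z = -(conj (f z) * dzbar (e j) g z)
      + ((μ : ℂ) - Complex.I * ν) / 2 * (conj (f z) * (z j * g z)) := fun z => by
    simp only [creation']; ring
  have i1 := H.integrable (H.left.dz j hf) hg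
  have i2 := H.integrable hf (H.right.coord_mul j hg)
  have i3 := H.integrable hf (H.right.dzbar j hg)
  simp only [e1, e2]
  rw [integral_add i1 (i2.const_mul _), integral_add i3.fun_neg (i2.const_mul _), integral_neg,
    H.integral_dz hf hg]

theorem integral_creation' (ν μ : ℝ) (j : Fin n) :
    ∫ z, conj (creation' ν μ j f z) * g z = ∫ z, conj (f z) * lower' ν μ j g z := by
  have e1 : ∀ z, conj (creation' ν μ j f z) * g z = -(conj (dzbar (e j) f z) * g z)
      + ((μ : ℂ) + Complex.I * ν) / 2 * (conj (f z) * (conj (z j) * g z)) := fun z => by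
    simp only [creation', map_add, map_mul, map_neg, map_sub, map_div₀, map_ofNat,
      Complex.conj_I, Complex.conj_ofReal]
    ring
  have e2 : ∀ z, conj (f z) * lower' ν μ j g z = conj (f z) * dz (e j) g z
      + ((μ : ℂ) + Complex.I * ν) / 2 * (conj (f z) * (conj (z j) * g z)) := fun z => by
    simp only [lower']; ring
  have i1 := H.integrable (H.left.dzbar j hf) hg
  have i2 := H.integrable hf (H.right.conj_mul j hg)
  have i3 := H.integrable hf (H.right.dz j hg)
  simp only [e1, e2]
  rw [integral_add i1.fun_neg (i2.const_mul _), integral_add i3 (i2.const_mul _), integral_neg,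
    H.integral_dzbar hf hg, neg_neg]

/-- In the factored form each summand is an operator times its own adjoint, and the remaining
constant is real. -/
theorem integral_laplacian (ν μ : ℝ) :
    ∫ z, conj (laplacian ν μ f z) * g z = ∫ z, conj (f z) * laplacian ν μ g z := by
  have hj : ∀ j, ∫ z, conj (creation ν μ j (lower ν μ j f) z) * g z
      = ∫ z, conj (f z) * creation ν μ j (lower ν μ j g) z := fun j => by
    rw [H.integral_creation (H.left.lower ν μ j hf) hg,
      H.integral_lower hf (H.right.lower ν μ j hg)]
  have e1 : ∀ z, conj (laplacian ν μ f z) * g z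
      = -4 * (∑ j, conj (creation ν μ j (lower ν μ j f) z) * g z)
        - 2 * μ * n * (conj (f z) * g z) := fun z => by
    rw [laplacian_eq ν μ (H.left.smooth hf), ← Finset.sum_mul]
    simp only [map_sub, map_mul, map_neg, map_ofNat, map_sum, Complex.conj_ofReal, map_natCast]
    ring
  have e2 : ∀ z, conj (f z) * laplacian ν μ g z
      = -4 * (∑ j, conj (f z) * creation ν μ j (lower ν μ j g) z)
        - 2 * μ * n * (conj (f z) * g z) := fun z => by
    rw [laplacian_eq ν μ (H.right.smooth hg), ← Finset.mul_sum]
    ring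
  have i0 := H.integrable hf hg
  have i1 : ∀ j ∈ Finset.univ,
      Integrable (fun z => conj (creation ν μ j (lower ν μ j f) z) * g z) := fun j _ =>
    H.integrable (H.left.creation ν μ j (H.left.lower ν μ j hf)) hg
  have i2 : ∀ j ∈ Finset.univ,
      Integrable (fun z => conj (f z) * creation ν μ j (lower ν μ j g) z) := fun j _ =>
    H.integrable hf (H.right.creation ν μ j (H.right.lower ν μ j hg))
  simp only [e1, e2]
  rw [integral_sub ((integrable_finsetSum _ i1).const_mul _) (i0.const_mul _),
    integral_sub ((integrable_finsetSum _ i2).const_mul _) (i0.const_mul _),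
    integral_const_mul, integral_const_mul, integral_const_mul,
    integral_finsetSum _ i1, integral_finsetSum _ i2]
  simp only [hj]

end Paired

theorem opClosed_smooth : OpClosed {f : (Fin n → ℂ) → ℂ | ContDiff ℝ ∞ f} where
  smooth hf := hf
  add {f g} (hf : ContDiff ℝ ∞ f) (hg : ContDiff ℝ ∞ g) := hf.add hg
  const_mul _ {f} (hf : ContDiff ℝ ∞ f) := contDiff_const.mul hf
  coord_mul j _ hf := (contDiff_coord j).mul hf
  conj_mul j _ hf := (contDiff_conj_coord j).mul hf
  dz _ _ hf := contDiff_dz hf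
  dzbar _ _ hf := contDiff_dzbar hf

theorem hasCompactSupport_dz {f : (Fin n → ℂ) → ℂ} (hf : HasCompactSupport f) (v : Fin n → ℂ) :
    HasCompactSupport (dz v f) := by
  refine (hf.fderiv (𝕜 := ℝ)).mono fun z hz => ?_
  contrapose! hz
  simp [dz, Function.notMem_support.1 hz]

theorem hasCompactSupport_dzbar {f : (Fin n → ℂ) → ℂ} (hf : HasCompactSupport f)
    (v : Fin n → ℂ) : HasCompactSupport (dzbar v f) := by
  refine (hf.fderiv (𝕜 := ℝ)).mono fun z hz => ?_
  contrapose! hz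
  simp [dzbar, Function.notMem_support.1 hz]

theorem opClosed_test :
    OpClosed {f : (Fin n → ℂ) → ℂ | ContDiff ℝ ∞ f ∧ HasCompactSupport f} where
  smooth hf := hf.1
  add hf hg := ⟨ContDiff.add hf.1 hg.1, HasCompactSupport.add hf.2 hg.2⟩
  const_mul _ _ hf := ⟨contDiff_const.mul hf.1, hf.2.mul_left⟩
  coord_mul j _ hf := ⟨(contDiff_coord j).mul hf.1, hf.2.mul_left⟩
  conj_mul j _ hf := ⟨(contDiff_conj_coord j).mul hf.1, hf.2.mul_left⟩
  dz _ _ hf := ⟨contDiff_dz hf.1, hasCompactSupport_dz hf.2 _⟩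
  dzbar _ _ hf := ⟨contDiff_dzbar hf.1, hasCompactSupport_dzbar hf.2 _⟩

/-- Compact support of one factor suffices, so a smooth function of any growth can be moved against
test functions. -/
theorem paired_test_smooth :
    Paired {f : (Fin n → ℂ) → ℂ | ContDiff ℝ ∞ f ∧ HasCompactSupport f}
      {f : (Fin n → ℂ) → ℂ | ContDiff ℝ ∞ f} where
  left := opClosed_test
  right := opClosed_smooth
  integrable {f g} hf hg := by
    refine Continuous.integrable_of_hasCompactSupport
      ((contDiff_conj hf.1).mul hg).continuous ?_
    exact (hf.2.comp_left (g := fun w => conj w) (map_zero _)).mul_right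

end Adjoint

/-! ### Gaussian decay, stability of the span, orthogonality. -/

section Span

/-- Completing the square in the exponent. -/
theorem mul_exp_le {B ε t : ℝ} (hε : 0 < ε) :
    Real.exp (B * t) ≤ Real.exp (B ^ 2 / (4 * ε)) * Real.exp (ε * t ^ 2) := by
  rw [← Real.exp_add, Real.exp_le_exp]
  have h1 : B ^ 2 / (4 * ε) + ε * t ^ 2 - B * t = (B - 2 * ε * t) ^ 2 / (4 * ε) := by
    field_simp; ring
  have h2 : 0 ≤ (B - 2 * ε * t) ^ 2 / (4 * ε) := by positivity
  linarith

theorem norm_gauss (b ξ : ℂ) : ‖gauss b ξ‖ = Real.exp (b.re * ‖ξ‖ ^ 2) := by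
  rw [gauss, Complex.norm_exp, Complex.re_mul_ofReal]

theorem norm_mul_exp_le {κ κ' : ℝ} (hκ : κ < κ') : ∃ C : ℝ, 0 ≤ C ∧ ∀ t : ℝ,
    t * Real.exp (-κ' * t ^ 2) ≤ C * Real.exp (-κ * t ^ 2) := by
  refine ⟨Real.exp (1 ^ 2 / (4 * (κ' - κ))), (Real.exp_pos _).le, fun t => ?_⟩
  have h1 := mul_exp_le (B := 1) (t := t) (sub_pos.2 hκ)
  have h2 : t ≤ Real.exp (1 * t) := by
    rw [one_mul]; linarith [Real.add_one_le_exp t]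
  calc t * Real.exp (-κ' * t ^ 2)
      ≤ (Real.exp (1 ^ 2 / (4 * (κ' - κ))) * Real.exp ((κ' - κ) * t ^ 2))
        * Real.exp (-κ' * t ^ 2) := by gcongr; exact h2.trans h1
    _ = _ := by rw [mul_assoc, ← Real.exp_add]; congr 2; ring

/-- Each recurrence step multiplies by ξ or ξ̄. The strict inequality κ < Re a leaves room to absorb
that factor by passing to a slightly larger rate. -/
theorem u_bound {a b : ℂ} (hab : a + b ≠ 0) (m k : ℕ) {κ : ℝ} (hκ : κ < a.re) :
    ∃ C : ℝ, 0 ≤ C ∧ ∀ ξ, ‖u a b m k ξ‖ ≤ C * Real.exp (-κ * ‖ξ‖ ^ 2) := by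
  have step : ∀ f : ℂ → ℂ,
      (∀ κ < a.re, ∃ C : ℝ, 0 ≤ C ∧ ∀ ξ, ‖f ξ‖ ≤ C * Real.exp (-κ * ‖ξ‖ ^ 2)) →
      ∀ κ < a.re, ∃ C : ℝ, 0 ≤ C ∧ ∀ ξ, ‖ξ‖ * ‖f ξ‖ ≤ C * Real.exp (-κ * ‖ξ‖ ^ 2) := by
    intro f hf κ hκ
    obtain ⟨κ', h1, h2⟩ := exists_between hκ
    obtain ⟨C, hC, hC'⟩ := hf κ' h2
    obtain ⟨D, hD, hD'⟩ := norm_mul_exp_le h1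
    refine ⟨C * D, by positivity, fun ξ => ?_⟩
    calc ‖ξ‖ * ‖f ξ‖ ≤ ‖ξ‖ * (C * Real.exp (-κ' * ‖ξ‖ ^ 2)) := by gcongr; exact hC' ξ
      _ = C * (‖ξ‖ * Real.exp (-κ' * ‖ξ‖ ^ 2)) := by ring
      _ ≤ C * (D * Real.exp (-κ * ‖ξ‖ ^ 2)) := mul_le_mul_of_nonneg_left (hD' _) hC
      _ = _ := by ring
  induction m generalizing k κ with
  | zero =>
    induction k generalizing κ with
    | zero =>
      refine ⟨1, zero_le_one, fun ξ => ?_⟩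
      have : -a.re * ‖ξ‖ ^ 2 ≤ -κ * ‖ξ‖ ^ 2 := by gcongr
      simpa [u, norm_gauss] using this
    | succ k ih =>
      obtain ⟨C, hC, hC'⟩ := step (u a b 0 k) (fun κ hκ => ih hκ) κ hκ
      refine ⟨C, hC, fun ξ => ?_⟩
      have := id_mul_u a b 0 k ξ
      rw [Nat.cast_zero, zero_mul, add_zero] at this
      rw [← this, norm_mul]
      exact hC' ξ
  | succ m ih =>
    obtain ⟨C, hC, hC'⟩ := step (u a b m k) (fun κ hκ => ih k hκ) κ hκ
    obtain ⟨D, hD, hD'⟩ := ih (k - 1) hκ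
    refine ⟨‖a + b‖ * C + k * D, by positivity, fun ξ => ?_⟩
    have h1 : u a b (m + 1) k ξ
        = (a + b) * (conj ξ * u a b m k ξ) - k * u a b m (k - 1) ξ := by
      rw [conj_mul_u]; ring
    rw [h1]
    refine (norm_sub_le _ _).trans ?_
    rw [norm_mul, norm_mul, norm_mul, RCLike.norm_conj, RCLike.norm_natCast]
    calc _ ≤ ‖a + b‖ * (C * Real.exp (-κ * ‖ξ‖ ^ 2)) + k * (D * Real.exp (-κ * ‖ξ‖ ^ 2)) := by
          exact add_le_add (mul_le_mul_of_nonneg_left (hC' ξ) (norm_nonneg _))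
            (mul_le_mul_of_nonneg_left (hD' ξ) (Nat.cast_nonneg k))
      _ = _ := by ring

variable {n : ℕ}

theorem exp_sqNorm (κ : ℝ) (z : Fin n → ℂ) :
    Real.exp (-κ * sqNorm z) = ∏ j, Real.exp (-κ * ‖z j‖ ^ 2) := by
  rw [← Real.exp_sum, sqNorm, Finset.mul_sum]

theorem h_bound (ν : ℝ) {μ : ℝ} (hμ : 0 < μ) (r s : Fin n → ℕ) :
    ∃ C : ℝ, 0 ≤ C ∧ ∀ z, ‖h ν μ r s z‖ ≤ C * Real.exp (-(μ / 4) * sqNorm z) := by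
  have hμ' : (μ : ℂ) ≠ 0 := mod_cast hμ.ne'
  have hab : ((μ : ℂ) + Complex.I * ν) / 2 + ((μ : ℂ) - Complex.I * ν) / 2 ≠ 0 := by
    convert hμ' using 1; ring
  have hre : (((μ : ℂ) + Complex.I * ν) / 2).re = μ / 2 := by simp
  -- Any rate below Re a = μ/2 would do; μ/4 is fixed from here on.
  choose C hC hC' using fun i => u_bound hab (r i) (s i) (κ := μ / 4) (by rw [hre]; linarith)
  refine ⟨∏ i, C i, Finset.prod_nonneg fun i _ => hC i, fun z => ?_⟩
  rw [h_eq_tensor, tensor, norm_prod, exp_sqNorm, ← Finset.prod_mul_distrib]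
  exact Finset.prod_le_prod (fun i _ => norm_nonneg _) fun i _ => hC' i (z i)

theorem continuous_sqNorm : Continuous (sqNorm : (Fin n → ℂ) → ℝ) := by
  unfold sqNorm; fun_prop

theorem memLp_exp_sqNorm {κ : ℝ} (hκ : 0 < κ) :
    MemLp (fun z : Fin n → ℂ => Real.exp (-κ * sqNorm z)) 2 volume := by
  have hc : Continuous fun z : Fin n → ℂ => Real.exp (-κ * sqNorm z) :=
    Real.continuous_exp.comp (continuous_const.mul continuous_sqNorm)
  rw [memLp_two_iff_integrable_sq hc.aestronglyMeasurable]
  have h1 : Integrable (fun ξ : ℂ => Real.exp (-(2 * κ) * ‖ξ‖ ^ 2)) := by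
    have := (GaussianFourier.integrable_cexp_neg_mul_sq_norm_add (V := ℂ) (b := ((2 * κ : ℝ) : ℂ))
      (by rw [Complex.ofReal_re]; linarith) 0 0).norm
    refine this.congr (ae_of_all _ fun ξ => ?_)
    simp only [zero_mul, add_zero, Complex.norm_exp]
    congr 1
    rw [← Complex.ofReal_pow, Complex.re_mul_ofReal]; simp
  have h2 := Integrable.fintype_prod (μ := fun _ : Fin n => (volume : Measure ℂ)) (fun _ => h1)
  refine h2.congr (ae_of_all _ fun z => ?_)
  simp only
  rw [← exp_sqNorm, ← Real.exp_nat_mul]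
  congr 1; push_cast; ring

/-- The linear span of the functions `h_{r,s}`. -/
def hspan (n : ℕ) (ν μ : ℝ) : Submodule ℂ ((Fin n → ℂ) → ℂ) :=
  Submodule.span ℂ (Set.range fun p : (Fin n → ℕ) × (Fin n → ℕ) => h ν μ p.1 p.2)

theorem h_mem_hspan (ν μ : ℝ) (r s : Fin n → ℕ) : h ν μ r s ∈ hspan n ν μ :=
  Submodule.subset_span ⟨(r, s), rfl⟩

theorem hspan_contDiff {ν μ : ℝ} {f : (Fin n → ℂ) → ℂ} (hf : f ∈ hspan n ν μ) :
    ContDiff ℝ ∞ f := by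
  induction hf using Submodule.span_induction with
  | mem f hf => obtain ⟨p, rfl⟩ := hf; exact contDiff_h ..
  | zero => exact contDiff_const
  | add f g _ _ hf hg => exact hf.add hg
  | smul c f _ hf => exact contDiff_const.mul hf

theorem hspan_bound {ν μ : ℝ} (hμ : 0 < μ) {f : (Fin n → ℂ) → ℂ} (hf : f ∈ hspan n ν μ) :
    ∃ C : ℝ, 0 ≤ C ∧ ∀ z, ‖f z‖ ≤ C * Real.exp (-(μ / 4) * sqNorm z) := by
  induction hf using Submodule.span_induction with
  | mem f hf => obtain ⟨p, rfl⟩ := hf; exact h_bound ν hμ _ _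
  | zero => exact ⟨0, le_rfl, fun z => by simp⟩
  | add f g _ _ hf hg =>
    obtain ⟨C, hC, hf⟩ := hf
    obtain ⟨D, hD, hg⟩ := hg
    refine ⟨C + D, by positivity, fun z => (norm_add_le _ _).trans ?_⟩
    rw [add_mul]; exact add_le_add (hf z) (hg z)
  | smul c f _ hf =>
    obtain ⟨C, hC, hf⟩ := hf
    refine ⟨‖c‖ * C, by positivity, fun z => ?_⟩
    rw [Pi.smul_apply, norm_smul, mul_assoc]
    gcongr
    exact hf z

theorem hspan_memLp {ν μ : ℝ} (hμ : 0 < μ) {f : (Fin n → ℂ) → ℂ} (hf : f ∈ hspan n ν μ) :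
    MemLp f 2 volume := by
  obtain ⟨C, hC, hf'⟩ := hspan_bound hμ hf
  exact (memLp_exp_sqNorm (by positivity : 0 < μ / 4)).of_le_mul
    (hspan_contDiff hf).continuous.aestronglyMeasurable
    (ae_of_all _ fun z => (hf' z).trans_eq (by rw [Real.norm_of_nonneg (Real.exp_pos _).le]))

/-- An operator which is additive and homogeneous on smooth functions and maps each `h_{r,s}`
into the span preserves the span. -/
theorem hspan_map {ν μ : ℝ} (T : ((Fin n → ℂ) → ℂ) → (Fin n → ℂ) → ℂ)
    (hadd : ∀ f g, ContDiff ℝ ∞ f → ContDiff ℝ ∞ g → T (f + g) = T f + T g)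
    (hmul : ∀ (c : ℂ) f, ContDiff ℝ ∞ f → T (c • f) = c • T f)
    (hT : ∀ r s, T (h ν μ r s) ∈ hspan n ν μ) {f : (Fin n → ℂ) → ℂ} (hf : f ∈ hspan n ν μ) :
    T f ∈ hspan n ν μ := by
  induction hf using Submodule.span_induction with
  | mem f hf => obtain ⟨p, rfl⟩ := hf; exact hT _ _
  | zero =>
    have := hmul 0 0 contDiff_const
    rw [zero_smul, zero_smul] at this
    rw [this]; exact zero_mem _
  | add f g hf hg hf' hg' =>
    rw [hadd f g (hspan_contDiff hf) (hspan_contDiff hg)]; exact add_mem hf' hg'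
  | smul c f hf hf' => rw [hmul c f (hspan_contDiff hf)]; exact Submodule.smul_mem _ _ hf'

theorem coord_mul_mem_hspan {ν μ : ℝ} (j : Fin n) {f : (Fin n → ℂ) → ℂ}
    (hf : f ∈ hspan n ν μ) : (fun z => z j * f z) ∈ hspan n ν μ := by
  refine hspan_map (fun f z => z j * f z) (fun f g _ _ => ?_) (fun c f _ => ?_)
    (fun r s => ?_) hf
  · ext z; simp [mul_add]
  · ext z; simp [mul_left_comm]
  · rw [funext (coord_mul_h ν μ r s j)]
    exact add_mem (h_mem_hspan _ _ _ _) (Submodule.smul_mem _ (r j : ℂ) (h_mem_hspan _ _ _ _))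

theorem conj_mul_mem_hspan {ν μ : ℝ} (hμ : μ ≠ 0) (j : Fin n) {f : (Fin n → ℂ) → ℂ}
    (hf : f ∈ hspan n ν μ) : (fun z => conj (z j) * f z) ∈ hspan n ν μ := by
  have hμ' : (μ : ℂ) ≠ 0 := mod_cast hμ
  refine hspan_map (fun f z => conj (z j) * f z) (fun f g _ _ => ?_) (fun c f _ => ?_)
    (fun r s => ?_) hf
  · ext z; simp [mul_add]
  · ext z; simp [mul_left_comm]
  · have : (fun z => conj (z j) * h ν μ r s z)
        = (μ : ℂ)⁻¹ • (h ν μ (Function.update r j (r j + 1)) s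
          + (s j : ℂ) • h ν μ r (Function.update s j (s j - 1))) := by
      ext z
      simp only [Pi.smul_apply, Pi.add_apply, smul_eq_mul]
      rw [← conj_coord_mul_h, inv_mul_cancel_left₀ hμ']
    rw [this]
    exact Submodule.smul_mem _ _ (add_mem (h_mem_hspan _ _ _ _)
      (Submodule.smul_mem _ _ (h_mem_hspan _ _ _ _)))

/-- ∂_j is `lower'` minus a multiple of multiplication by z̄_j, and both preserve the span. -/
theorem dz_mem_hspan {ν μ : ℝ} (hμ : μ ≠ 0) (j : Fin n) {f : (Fin n → ℂ) → ℂ}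
    (hf : f ∈ hspan n ν μ) : dz (e j) f ∈ hspan n ν μ := by
  refine hspan_map (dz (e j)) (fun f g hf hg => ?_) (fun c f hf => ?_) (fun r s => ?_) hf
  · ext z; exact dz_add hf.differentiableAt_real hg.differentiableAt_real
  · ext z; exact dz_const_mul c hf.differentiableAt_real
  · have : dz (e j) (h ν μ r s) = lower' ν μ j (h ν μ r s)
        - (((μ : ℂ) + Complex.I * ν) / 2) • (fun z => conj (z j) * h ν μ r s z) := by
      ext z; simp [lower']; ring
    rw [this, lower'_h]
    exact sub_mem (Submodule.smul_mem _ (s j : ℂ) (h_mem_hspan _ _ _ _))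
      (Submodule.smul_mem _ _ (conj_mul_mem_hspan hμ j (h_mem_hspan _ _ _ _)))

theorem dzbar_mem_hspan {ν μ : ℝ} (j : Fin n) {f : (Fin n → ℂ) → ℂ}
    (hf : f ∈ hspan n ν μ) : dzbar (e j) f ∈ hspan n ν μ := by
  refine hspan_map (dzbar (e j)) (fun f g hf hg => ?_) (fun c f hf => ?_) (fun r s => ?_) hf
  · ext z; exact dzbar_add hf.differentiableAt_real hg.differentiableAt_real
  · ext z; exact dzbar_const_mul c hf.differentiableAt_real
  · have : dzbar (e j) (h ν μ r s) = lower ν μ j (h ν μ r s)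
        - (((μ : ℂ) + Complex.I * ν) / 2) • (fun z => z j * h ν μ r s z) := by
      ext z; simp [lower]; ring
    rw [this, lower_h]
    exact sub_mem (Submodule.smul_mem _ ((μ : ℂ) * r j) (h_mem_hspan _ _ _ _))
      (Submodule.smul_mem _ _ (coord_mul_mem_hspan j (h_mem_hspan _ _ _ _)))

theorem opClosed_hspan (ν : ℝ) {μ : ℝ} (hμ : μ ≠ 0) :
    OpClosed (hspan n ν μ : Set ((Fin n → ℂ) → ℂ)) where
  smooth hf := hspan_contDiff hf
  add hf hg := add_mem hf hg
  const_mul c _ hf := Submodule.smul_mem _ c hf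
  coord_mul j _ hf := coord_mul_mem_hspan j hf
  conj_mul j _ hf := conj_mul_mem_hspan hμ j hf
  dz j _ hf := dz_mem_hspan hμ j hf
  dzbar j _ hf := dzbar_mem_hspan j hf

theorem memLp_conj {f : (Fin n → ℂ) → ℂ} (hf : MemLp f 2 volume) :
    MemLp (fun z => conj (f z)) 2 volume :=
  hf.star

theorem paired_hspan (ν : ℝ) {μ : ℝ} (hμ : 0 < μ) :
    Paired (hspan n ν μ : Set ((Fin n → ℂ) → ℂ)) (hspan n ν μ) where
  left := opClosed_hspan ν hμ.ne'
  right := opClosed_hspan ν hμ.ne'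
  integrable hf hg := (memLp_conj (hspan_memLp hμ hf)).integrable_mul (hspan_memLp hμ hg)

/-- Eigenfunctions of a symmetric operator with distinct real eigenvalues are orthogonal. If r_j ≠
r'_j the operator is the number operator of the first ladder at j; if r = r', some s_j ≠ s'_j and
the second ladder serves. -/
theorem h_orthogonal (ν : ℝ) {μ : ℝ} (hμ : 0 < μ) {r s r' s' : Fin n → ℕ}
    (hne : (r, s) ≠ (r', s')) : ∫ z, conj (h ν μ r s z) * h ν μ r' s' z = 0 := by
  have H := paired_hspan (n := n) ν hμ
  have h1 := h_mem_hspan (n := n) ν μ r s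
  have h2 := h_mem_hspan (n := n) ν μ r' s'
  have hμ' : (μ : ℂ) ≠ 0 := mod_cast hμ.ne'
  have key : ∀ (k k' : ℕ), k ≠ k' →
      ∫ z, conj (μ * k * h ν μ r s z) * h ν μ r' s' z
        = ∫ z, conj (h ν μ r s z) * (μ * k' * h ν μ r' s' z) →
      ∫ z, conj (h ν μ r s z) * h ν μ r' s' z = 0 := by
    intro k k' hk heq
    simp only [map_mul, Complex.conj_ofReal, map_natCast, mul_assoc, mul_left_comm (conj _)] at heq
    simp only [integral_const_mul] at heq
    have heq := mul_left_cancel₀ hμ' heq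
    have hk' : (k : ℂ) - k' ≠ 0 := sub_ne_zero.2 (mod_cast hk)
    refine (mul_eq_zero.1 ?_).resolve_left hk'
    linear_combination heq
  by_cases hr : r = r'
  · have hs : s ≠ s' := fun hs => hne (by rw [hr, hs])
    obtain ⟨j, hj⟩ := Function.ne_iff.1 hs
    refine key _ _ hj ?_
    have e1 := congrFun (creation'_lower'_h ν μ r s j)
    have e2 := congrFun (creation'_lower'_h ν μ r' s' j)
    simp only [← e1, ← e2]
    rw [H.integral_creation' (H.left.lower' ν μ j h1) h2,
      H.integral_lower' h1 (H.right.lower' ν μ j h2)]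
  · obtain ⟨j, hj⟩ := Function.ne_iff.1 hr
    refine key _ _ hj ?_
    have e1 := congrFun (creation_lower_h ν μ r s j)
    have e2 := congrFun (creation_lower_h ν μ r' s' j)
    simp only [← e1, ← e2]
    rw [H.integral_creation (H.left.lower ν μ j h1) h2,
      H.integral_lower h1 (H.right.lower ν μ j h2)]

end Span

/-! ### Completeness through uniqueness of the Fourier transform. -/

section Completeness

/-- The positive and negative parts of g are densities of finite measures with equal characteristic
functions. The measures therefore coincide, so g⁺ = g⁻ almost everywhere, which forces g = 0. -/
theorem ae_eq_zero_of_integral_exp_real {E : Type*} [NormedAddCommGroup E] [NormedSpace ℝ E]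
    [MeasurableSpace E] [BorelSpace E] [SecondCountableTopology E] [CompleteSpace E]
    {ρ : Measure E} {g : E → ℝ} (hg : Integrable g ρ)
    (h0 : ∀ L : StrongDual ℝ E, ∫ z, Complex.exp (L z * Complex.I) * (g z : ℂ) ∂ρ = 0) :
    g =ᵐ[ρ] 0 := by
  have hm : AEMeasurable (fun z => ENNReal.ofReal (g z)) ρ := hg.aemeasurable.ennreal_ofReal
  have hm' : AEMeasurable (fun z => ENNReal.ofReal (-g z)) ρ := hg.neg.aemeasurable.ennreal_ofReal
  have := isFiniteMeasure_withDensity_ofReal hg.2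
  have := isFiniteMeasure_withDensity_ofReal hg.neg.2
  have hI : ∀ (L : StrongDual ℝ E) {p : E → ℝ}, Integrable p ρ →
      Integrable (fun z => Complex.exp (L z * Complex.I) * (p z : ℂ)) ρ := by
    intro L p hp
    refine hp.ofReal.bdd_mul (c := 1) ?_ (ae_of_all _ fun z => ?_)
    · exact (by fun_prop : Continuous fun z => Complex.exp (L z * Complex.I)).aestronglyMeasurable
    · rw [Complex.norm_exp_ofReal_mul_I]
  have key : ρ.withDensity (fun z => ENNReal.ofReal (g z))
      = ρ.withDensity (fun z => ENNReal.ofReal (-g z)) := by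
    refine Measure.ext_of_charFunDual (funext fun L => ?_)
    rw [charFunDual_apply, charFunDual_apply, integral_withDensity_eq_integral_toReal_smul₀ hm
      (ae_of_all _ fun _ => ENNReal.ofReal_lt_top), integral_withDensity_eq_integral_toReal_smul₀
      hm' (ae_of_all _ fun _ => ENNReal.ofReal_lt_top), ← sub_eq_zero]
    have e1 : ∀ p : E → ℝ, (fun z => (ENNReal.ofReal (p z)).toReal • Complex.exp (L z * Complex.I))
        = fun z => Complex.exp (L z * Complex.I) * ((max (p z) 0 : ℝ) : ℂ) := by
      intro p; ext z
      rw [ENNReal.toReal_ofReal', Complex.real_smul, mul_comm]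
    rw [e1, e1, ← integral_sub (hI L hg.pos_part) (hI L (p := fun z => max (-g z) 0) hg.neg_part),
      ← h0 L]
    refine integral_congr_ae (ae_of_all _ fun z => ?_)
    simp only
    rw [← mul_sub, ← Complex.ofReal_sub]
    congr 2
    rcases le_total (g z) 0 with h | h
    · rw [max_eq_right h, max_eq_left (by linarith)]; ring
    · rw [max_eq_left h, max_eq_right (by linarith)]; ring
  have hfin : ∫⁻ z, ENNReal.ofReal (g z) ∂ρ ≠ ⊤ :=
    (lt_of_le_of_lt (lintegral_mono fun z => Real.ofReal_le_enorm (g z)) hg.2).ne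
  filter_upwards [(withDensity_eq_iff hm hm' hfin).1 key] with z hz
  rcases le_total (g z) 0 with h | h
  · rw [ENNReal.ofReal_of_nonpos h, eq_comm, ENNReal.ofReal_eq_zero] at hz
    exact le_antisymm h (neg_nonpos.1 hz)
  · rw [ENNReal.ofReal_of_nonpos (by linarith : -g z ≤ 0), ENNReal.ofReal_eq_zero] at hz
    exact le_antisymm hz h

theorem ae_eq_zero_of_integral_exp {E : Type*} [NormedAddCommGroup E] [NormedSpace ℝ E]
    [MeasurableSpace E] [BorelSpace E] [SecondCountableTopology E] [CompleteSpace E]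
    {ρ : Measure E} {g : E → ℂ} (hg : Integrable g ρ)
    (h0 : ∀ L : StrongDual ℝ E, ∫ z, Complex.exp (L z * Complex.I) * g z ∂ρ = 0) :
    g =ᵐ[ρ] 0 := by
  have hI : ∀ (L : StrongDual ℝ E) {p : E → ℂ}, Integrable p ρ →
      Integrable (fun z => Complex.exp (L z * Complex.I) * p z) ρ := by
    intro L p hp
    refine hp.bdd_mul (c := 1) ?_ (ae_of_all _ fun z => ?_)
    · exact (by fun_prop : Continuous fun z => Complex.exp (L z * Complex.I)).aestronglyMeasurable
    · rw [Complex.norm_exp_ofReal_mul_I]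
  have hgc : Integrable (fun z => conj (g z)) ρ :=
    (Complex.conjCLE.toContinuousLinearMap.integrable_comp hg)
  -- Conjugating the hypothesis at -L shows that the transform of conj g vanishes too, which
  -- separates real and imaginary parts.
  have h1 : ∀ L : StrongDual ℝ E, ∫ z, Complex.exp (L z * Complex.I) * conj (g z) ∂ρ = 0 := by
    intro L
    have := congrArg conj (h0 (-L))
    rw [← integral_conj, map_zero] at this
    rw [← this]
    refine integral_congr_ae (ae_of_all _ fun z => ?_)
    simp [← Complex.exp_conj]
  have hre : (fun z => (g z).re) =ᵐ[ρ] 0 := by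
    refine ae_eq_zero_of_integral_exp_real hg.re fun L => ?_
    have e1 : ∀ z, Complex.exp (L z * Complex.I) * ((g z).re : ℂ)
        = (1 / 2) * (Complex.exp (L z * Complex.I) * g z
          + Complex.exp (L z * Complex.I) * conj (g z)) := fun z => by
      rw [← mul_add, Complex.add_conj]; push_cast; ring
    simp only [e1]
    rw [integral_const_mul, integral_add (hI L hg) (hI L hgc), h0, h1]; simp
  have him : (fun z => (g z).im) =ᵐ[ρ] 0 := by
    refine ae_eq_zero_of_integral_exp_real hg.im fun L => ?_
    have e1 : ∀ z, Complex.exp (L z * Complex.I) * ((g z).im : ℂ)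
        = (-Complex.I / 2) * (Complex.exp (L z * Complex.I) * g z
          - Complex.exp (L z * Complex.I) * conj (g z)) := fun z => by
      rw [← mul_sub, Complex.sub_conj]; push_cast
      linear_combination (Complex.exp (L z * Complex.I) * ((g z).im : ℂ)) * Complex.I_sq
    simp only [e1]
    rw [integral_const_mul, integral_sub (hI L hg) (hI L hgc), h0, h1]; simp
  filter_upwards [hre, him] with z h1 h2
  exact Complex.ext h1 h2

variable {n : ℕ}

/-- The norm of `Fin n → ℂ` is the sup norm, while the Gaussians use the Euclidean one. -/
theorem norm_sq_le_sqNorm (z : Fin n → ℂ) : ‖z‖ ^ 2 ≤ sqNorm z := by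
  have h0 : 0 ≤ sqNorm z := Finset.sum_nonneg fun i _ => by positivity
  have : ‖z‖ ≤ Real.sqrt (sqNorm z) := by
    refine (pi_norm_le_iff_of_nonneg (Real.sqrt_nonneg _)).2 fun i => Real.le_sqrt_of_sq_le ?_
    exact Finset.single_le_sum (f := fun i => ‖z i‖ ^ 2) (fun i _ => by positivity)
      (Finset.mem_univ i)
  calc ‖z‖ ^ 2 ≤ Real.sqrt (sqNorm z) ^ 2 := by gcongr
    _ = sqNorm z := Real.sq_sqrt h0

/-- Expressing L through z_j and z̄_j makes multiplication by L an operation that preserves the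
span. -/
theorem dual_apply_eq (L : StrongDual ℝ (Fin n → ℂ)) (z : Fin n → ℂ) :
    (L z : ℂ) = ∑ j, (((L (e j) : ℂ) - Complex.I * L (Complex.I • e j)) / 2 * z j
      + ((L (e j) : ℂ) + Complex.I * L (Complex.I • e j)) / 2 * conj (z j)) := by
  have hz : z = ∑ j, ((z j).re • e j + (z j).im • (Complex.I • e j)) := by
    ext i
    rw [Finset.sum_apply, Finset.sum_eq_single i]
    · simp [e, mul_comm Complex.I]
    · intro j _ hj; simp [e, hj.symm]
    · simp
  conv_lhs => rw [hz]
  simp only [map_sum, map_add, map_smul, smul_eq_mul]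
  push_cast
  refine Finset.sum_congr rfl fun j _ => ?_
  have h1 := Complex.re_add_im (z j)
  have h2 : conj (z j) = (z j).re - (z j).im * Complex.I := by
    apply Complex.ext <;> simp
  rw [h2]
  conv_rhs => rw [← h1]
  simp only [Complex.add_re, Complex.ofReal_re, Complex.mul_re, Complex.I_re, Complex.ofReal_im,
    Complex.I_im, Complex.add_im, Complex.mul_im]
  push_cast
  linear_combination ((z j).im : ℂ) * L (Complex.I • e j) * Complex.I_sq

theorem dual_pow_mul_mem_hspan {ν μ : ℝ} (hμ : μ ≠ 0) (L : StrongDual ℝ (Fin n → ℂ)) (k : ℕ)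
    {f : (Fin n → ℂ) → ℂ} (hf : f ∈ hspan n ν μ) :
    (fun z => (L z : ℂ) ^ k * f z) ∈ hspan n ν μ := by
  induction k with
  | zero => simpa using hf
  | succ k ih =>
    have : (fun z => (L z : ℂ) ^ (k + 1) * f z) = ∑ j,
        ((((L (e j) : ℂ) - Complex.I * L (Complex.I • e j)) / 2) •
            (fun z : Fin n → ℂ => z j * ((L z : ℂ) ^ k * f z))
          + (((L (e j) : ℂ) + Complex.I * L (Complex.I • e j)) / 2) •
            (fun z : Fin n → ℂ => conj (z j) * ((L z : ℂ) ^ k * f z))) := by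
      ext z
      rw [Finset.sum_apply, pow_succ', mul_assoc, dual_apply_eq L z, Finset.sum_mul]
      refine Finset.sum_congr rfl fun j _ => ?_
      simp only [Pi.add_apply, Pi.smul_apply, smul_eq_mul]
      rw [← dual_apply_eq L z]
      ring
    rw [this]
    exact sum_mem fun j _ => add_mem (Submodule.smul_mem _ _ (coord_mul_mem_hspan j ih))
      (Submodule.smul_mem _ _ (conj_mul_mem_hspan hμ j ih))

theorem integral_conj_hspan_eq_zero {ν μ : ℝ} (hμ : 0 < μ) {F : (Fin n → ℂ) → ℂ}
    (hF : MemLp F 2 volume) (h0 : ∀ r s, ∫ z, conj (h ν μ r s z) * F z = 0)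
    {f : (Fin n → ℂ) → ℂ} (hf : f ∈ hspan n ν μ) : ∫ z, conj (f z) * F z = 0 := by
  induction hf using Submodule.span_induction with
  | mem f hf => obtain ⟨p, rfl⟩ := hf; exact h0 _ _
  | zero => simp
  | add f g hf hg hf' hg' =>
    have h1 := (memLp_conj (hspan_memLp hμ hf)).integrable_mul hF
    have h2 := (memLp_conj (hspan_memLp hμ hg)).integrable_mul hF
    simp only [Pi.add_apply, map_add, add_mul]
    rw [← add_zero (0 : ℂ)]
    nth_rewrite 1 [← hf']
    rw [← hg']
    exact integral_add h1 h2
  | smul c f _ hf =>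
    simp only [Pi.smul_apply, smul_eq_mul, map_mul, mul_assoc]
    rw [integral_const_mul, hf, mul_zero]

theorem ae_eq_zero_of_orthogonal_h {ν μ : ℝ} (hμ : 0 < μ) {F : (Fin n → ℂ) → ℂ}
    (hF : MemLp F 2 volume) (h0 : ∀ r s, ∫ z, conj (h ν μ r s z) * F z = 0) :
    F =ᵐ[volume] 0 := by
  set g : (Fin n → ℂ) → ℂ := h ν μ 0 0 with hg
  have hgm : g ∈ hspan n ν μ := h_mem_hspan _ _ _ _
  have hGi : Integrable (fun z => conj (g z) * F z) :=
    (memLp_conj (hspan_memLp hμ hgm)).integrable_mul hF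
  have hg0 : ∀ z, g z ≠ 0 := by
    intro z
    rw [hg, h_eq_tensor]
    exact Finset.prod_ne_zero_iff.2 fun i _ => by simp [u, gauss_ne_zero]
  suffices hz : (fun z => conj (g z) * F z) =ᵐ[volume] 0 by
    filter_upwards [hz] with z hz
    exact (mul_eq_zero.1 hz).resolve_left (by simpa using hg0 z)
  refine ae_eq_zero_of_integral_exp hGi fun L => ?_
  -- exp|L z| costs at most a constant times exp(μ|z|²/8). Half of the decay exp(-μ|z|²/4) of g
  -- survives, and it is square integrable against F.
  have hbound : Integrable (fun z => Real.exp |L z| * ‖conj (g z) * F z‖) := by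
    obtain ⟨C, hC, hC'⟩ := hspan_bound hμ hgm
    have hD := ((memLp_exp_sqNorm (n := n) (by positivity : 0 < μ / 8)).integrable_mul
      hF.norm).const_mul (C * Real.exp (‖L‖ ^ 2 / (4 * (μ / 8))))
    refine hD.mono' (((by fun_prop : Continuous fun z => Real.exp |L z|)).aestronglyMeasurable.mul
      hGi.norm.aestronglyMeasurable) (ae_of_all _ fun z => ?_)
    have h1 : Real.exp |L z| ≤ Real.exp (‖L‖ ^ 2 / (4 * (μ / 8))) *
        Real.exp (μ / 8 * sqNorm z) := by
      calc Real.exp |L z| ≤ Real.exp (‖L‖ * ‖z‖) := Real.exp_le_exp.2 (L.le_opNorm z)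
        _ ≤ _ := mul_exp_le (by positivity : 0 < μ / 8)
        _ ≤ _ := by gcongr; exact norm_sq_le_sqNorm z
    rw [Real.norm_of_nonneg (by positivity), norm_mul, RCLike.norm_conj]
    calc Real.exp |L z| * (‖g z‖ * ‖F z‖)
        ≤ (Real.exp (‖L‖ ^ 2 / (4 * (μ / 8))) * Real.exp (μ / 8 * sqNorm z)) *
          ((C * Real.exp (-(μ / 4) * sqNorm z)) * ‖F z‖) := by gcongr; exact hC' z
      _ = C * Real.exp (‖L‖ ^ 2 / (4 * (μ / 8))) *
          ((Real.exp (μ / 8 * sqNorm z) * Real.exp (-(μ / 4) * sqNorm z)) * ‖F z‖) := by ring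
      _ = _ := by
        rw [← Real.exp_add]
        simp only [Pi.mul_apply]
        congr 4; ring
  have hexp : ∀ z, HasSum (fun k : ℕ => |L z| ^ k / k.factorial) (Real.exp |L z|) := fun z => by
    rw [Real.exp_eq_exp_ℝ]; exact NormedSpace.expSeries_div_hasSum_exp _
  -- The series of exp(iL) is integrated term by term; every term is a moment, which vanishes since
  -- L^k g lies in the span.
  have hs := hasSum_integral_of_dominated_convergence (μ := volume)
    (F := fun (k : ℕ) z => (L z * Complex.I) ^ k / k.factorial * (conj (g z) * F z))
    (f := fun z => Complex.exp (L z * Complex.I) * (conj (g z) * F z))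
    (fun k z => |L z| ^ k / k.factorial * ‖conj (g z) * F z‖)
    (fun k => (by fun_prop : Continuous fun z => (L z * Complex.I) ^ k / (k.factorial : ℂ)
      ).aestronglyMeasurable.mul hGi.aestronglyMeasurable)
    (fun k => ae_of_all _ fun z => by
      rw [norm_mul, norm_div, norm_pow, norm_mul, Complex.norm_I, mul_one, Complex.norm_real,
        RCLike.norm_natCast, Real.norm_eq_abs])
    (ae_of_all _ fun z => ((hexp z).mul_right _).summable)
    (by
      refine hbound.congr (ae_of_all _ fun z => ?_)
      exact (((hexp z).mul_right _).tsum_eq).symm)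
    (ae_of_all _ fun z => by
      refine HasSum.mul_right _ ?_
      rw [Complex.exp_eq_exp_ℂ]; exact NormedSpace.expSeries_div_hasSum_exp _)
  refine hs.unique ?_
  have hzero : ∀ k : ℕ,
      ∫ z, (L z * Complex.I) ^ k / k.factorial * (conj (g z) * F z) = 0 := by
    intro k
    have h1 := integral_conj_hspan_eq_zero hμ hF h0 (dual_pow_mul_mem_hspan hμ.ne' L k hgm)
    have e1 : ∀ z, (L z * Complex.I) ^ k / k.factorial * (conj (g z) * F z)
        = Complex.I ^ k / k.factorial * (conj ((L z : ℂ) ^ k * g z) * F z) := fun z => by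
      rw [map_mul, map_pow, Complex.conj_ofReal, mul_pow]; ring
    simp only [e1]
    rw [integral_const_mul, h1, mul_zero]
  simp only [hzero]
  exact hasSum_zero

end Completeness

/-! ### Extending the weak equation from test functions to the span. -/

section Cutoff

theorem fderiv_comp_ofReal_smul {E : Type*} [NormedAddCommGroup E] [NormedSpace ℂ E] (p : E → ℂ)
    (c : ℝ) (z v : E) :
    fderiv ℝ (fun z => p ((c : ℂ) • z)) z v = c * fderiv ℝ p ((c : ℂ) • z) v := by
  have := congrArg (fun T => T v) (fderiv_comp_smul (f := p) (x := z) c)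
  simpa only [smul_apply, Complex.real_smul, Complex.coe_smul] using this

theorem dz_comp_ofReal_smul {E : Type*} [NormedAddCommGroup E] [NormedSpace ℂ E] (p : E → ℂ)
    (c : ℝ) (v : E) :
    dz v (fun z => p ((c : ℂ) • z)) = fun z => c * dz v p ((c : ℂ) • z) := by
  ext z; simp only [dz, fderiv_comp_ofReal_smul]; ring

theorem dzbar_comp_ofReal_smul {E : Type*} [NormedAddCommGroup E] [NormedSpace ℂ E] (p : E → ℂ)
    (c : ℝ) (v : E) :
    dzbar v (fun z => p ((c : ℂ) • z)) = fun z => c * dzbar v p ((c : ℂ) • z) := by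
  ext z; simp only [dzbar, fderiv_comp_ofReal_smul]; ring

variable {n : ℕ}

theorem creation_mul (ν μ : ℝ) (j : Fin n) {p f : (Fin n → ℂ) → ℂ} (hp : ContDiff ℝ ∞ p)
    (hf : ContDiff ℝ ∞ f) (z : Fin n → ℂ) :
    creation ν μ j (fun z => p z * f z) z = p z * creation ν μ j f z - dz (e j) p z * f z := by
  rw [creation, creation, dz_mul hp.differentiableAt_real hf.differentiableAt_real]; ring

theorem creation_add (ν μ : ℝ) (j : Fin n) {f g : (Fin n → ℂ) → ℂ} (hf : ContDiff ℝ ∞ f)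
    (hg : ContDiff ℝ ∞ g) (z : Fin n → ℂ) :
    creation ν μ j (fun z => f z + g z) z = creation ν μ j f z + creation ν μ j g z := by
  rw [creation, creation, creation, dz_add hf.differentiableAt_real hg.differentiableAt_real]; ring

theorem lower_mul (ν μ : ℝ) (j : Fin n) {p f : (Fin n → ℂ) → ℂ} (hp : ContDiff ℝ ∞ p)
    (hf : ContDiff ℝ ∞ f) :
    lower ν μ j (fun z => p z * f z) = fun z => p z * lower ν μ j f z + dzbar (e j) p z * f z := by
  ext z
  rw [lower, lower, dzbar_mul hp.differentiableAt_real hf.differentiableAt_real]; ring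

theorem laplacian_mul (ν μ : ℝ) {p f : (Fin n → ℂ) → ℂ} (hp : ContDiff ℝ ∞ p)
    (hf : ContDiff ℝ ∞ f) (z : Fin n → ℂ) :
    laplacian ν μ (fun z => p z * f z) z = p z * laplacian ν μ f z
      - 4 * ∑ j, (-(dz (e j) p z * lower ν μ j f z) + dzbar (e j) p z * creation ν μ j f z
        - dz (e j) (dzbar (e j) p) z * f z) := by
  rw [laplacian_eq ν μ (hp.mul hf), laplacian_eq ν μ hf]
  have key : ∀ j, creation ν μ j (lower ν μ j fun z => p z * f z) z
      = p z * creation ν μ j (lower ν μ j f) z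
        + (-(dz (e j) p z * lower ν μ j f z) + dzbar (e j) p z * creation ν μ j f z
        - dz (e j) (dzbar (e j) p) z * f z) := by
    intro j
    have hl : ContDiff ℝ ∞ (lower ν μ j f) := opClosed_smooth.lower ν μ j hf
    rw [lower_mul ν μ j hp hf, creation_add ν μ j (hp.mul hl) ((contDiff_dzbar hp).mul hf),
      creation_mul ν μ j hp hl, creation_mul ν μ j (contDiff_dzbar hp) hf]
    ring
  simp only [key, Finset.sum_add_distrib, ← Finset.mul_sum]
  ring

theorem contDiff_dilate {p : (Fin n → ℂ) → ℂ} (hp : ContDiff ℝ ∞ p) (t : ℝ) :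
    ContDiff ℝ ∞ (fun z : Fin n → ℂ => p ((t : ℂ) • z)) :=
  hp.comp (contDiff_const.fun_smul contDiff_fun_id)

/-- Every derivative falling on the dilated cutoff carries a factor c, so all commutator terms
vanish pointwise as c → 0. -/
theorem laplacian_dilate_mul (ν μ : ℝ) {p f : (Fin n → ℂ) → ℂ} (hp : ContDiff ℝ ∞ p)
    (hf : ContDiff ℝ ∞ f) (c : ℝ) (z : Fin n → ℂ) :
    laplacian ν μ (fun z => p ((c : ℂ) • z) * f z) z = p ((c : ℂ) • z) * laplacian ν μ f z
      - 4 * ∑ j, (-(c * dz (e j) p ((c : ℂ) • z) * lower ν μ j f z)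
        + c * dzbar (e j) p ((c : ℂ) • z) * creation ν μ j f z
        - c * (c * dz (e j) (dzbar (e j) p) ((c : ℂ) • z)) * f z) := by
  have h2 : ∀ j, dz (e j) (fun z : Fin n → ℂ => c * dzbar (e j) p ((c : ℂ) • z)) z
      = c * (c * dz (e j) (dzbar (e j) p) ((c : ℂ) • z)) := fun j => by
    rw [dz_const_mul _ (contDiff_dilate (contDiff_dzbar hp) c).differentiableAt_real,
      dz_comp_ofReal_smul]
  rw [laplacian_mul ν μ (contDiff_dilate hp c) hf]
  simp only [dzbar_comp_ofReal_smul, h2, dz_comp_ofReal_smul]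

theorem laplacian_mem_hspan {ν μ : ℝ} (hμ : μ ≠ 0) {f : (Fin n → ℂ) → ℂ}
    (hf : f ∈ hspan n ν μ) : laplacian ν μ f ∈ hspan n ν μ := by
  have H := opClosed_hspan (n := n) ν hμ
  have : laplacian ν μ f = (-4 : ℂ) • ∑ j, creation ν μ j (lower ν μ j f)
      - (2 * μ * n : ℂ) • f := by
    ext z
    rw [laplacian_eq ν μ (hspan_contDiff hf)]
    simp
  rw [this]
  exact sub_mem (Submodule.smul_mem _ _ (sum_mem fun j _ => H.creation ν μ j (H.lower ν μ j hf)))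
    (Submodule.smul_mem _ _ hf)

theorem contDiff_laplacian (ν μ : ℝ) {f : (Fin n → ℂ) → ℂ} (hf : ContDiff ℝ ∞ f) :
    ContDiff ℝ ∞ (laplacian ν μ f) := by
  have h2 : ∀ j, ContDiff ℝ ∞ (creation ν μ j (lower ν μ j f)) := fun j =>
    opClosed_smooth.creation ν μ j (opClosed_smooth.lower ν μ j hf)
  rw [funext (laplacian_eq ν μ hf)]
  exact (contDiff_const.mul (ContDiff.sum fun j _ => h2 j)).sub (contDiff_const.mul hf)

theorem exists_bound_of_test {q : (Fin n → ℂ) → ℂ} (hq : ContDiff ℝ ∞ q ∧ HasCompactSupport q) :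
    ∃ M, ∀ z, ‖q z‖ ≤ M :=
  hq.2.exists_bound_of_continuous hq.1.continuous

theorem tendsto_integral_dilate_mul {p : (Fin n → ℂ) → ℂ}
    (hp : ContDiff ℝ ∞ p ∧ HasCompactSupport p) (hp0 : p 0 = 1) {t : ℕ → ℝ}
    (ht : Filter.Tendsto t Filter.atTop (nhds 0)) {ν μ : ℝ} (hμ : 0 < μ) {F : (Fin n → ℂ) → ℂ}
    (hF : MemLp F 2 volume) {f : (Fin n → ℂ) → ℂ} (hf : f ∈ hspan n ν μ) :
    Filter.Tendsto (fun k => ∫ z, conj (p ((t k : ℂ) • z) * f z) * F z) Filter.atTop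
      (nhds (∫ z, conj (f z) * F z)) := by
  obtain ⟨M, hM⟩ := exists_bound_of_test hp
  refine tendsto_integral_of_dominated_convergence (fun z => M * (‖f z‖ * ‖F z‖)) ?_ ?_ ?_ ?_
  · exact fun k => (contDiff_conj ((contDiff_dilate hp.1 _).mul
      (hspan_contDiff hf))).continuous.aestronglyMeasurable.mul hF.aestronglyMeasurable
  · exact (((hspan_memLp hμ hf).norm).integrable_mul hF.norm).const_mul M
  · refine fun k => ae_of_all _ fun z => ?_
    rw [norm_mul, RCLike.norm_conj, norm_mul, mul_assoc]
    exact mul_le_mul_of_nonneg_right (hM _) (by positivity)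
  · refine ae_of_all _ fun z => ?_
    have hc : Continuous fun t : ℝ => conj (p ((t : ℂ) • z) * f z) * F z := by
      have := hp.1.continuous
      fun_prop
    have := (hc.tendsto 0).comp ht
    simpa [Function.comp_def, hp0] using this

/-- A bound uniform in |c| ≤ 1, to serve as the majorant for dominated convergence. The linear
growth of the coefficients is harmless, being contained in `lower` and `creation` of f. -/
theorem norm_laplacian_dilate_mul_le (ν μ : ℝ) {p f : (Fin n → ℂ) → ℂ} (hp : ContDiff ℝ ∞ p)
    (hf : ContDiff ℝ ∞ f) {M : ℝ} {M1 M2 M3 : Fin n → ℝ} (hM : ∀ z, ‖p z‖ ≤ M)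
    (hM1 : ∀ j z, ‖dz (e j) p z‖ ≤ M1 j) (hM2 : ∀ j z, ‖dzbar (e j) p z‖ ≤ M2 j)
    (hM3 : ∀ j z, ‖dz (e j) (dzbar (e j) p) z‖ ≤ M3 j) {c : ℝ} (hc : |c| ≤ 1)
    (z : Fin n → ℂ) :
    ‖laplacian ν μ (fun z => p ((c : ℂ) • z) * f z) z‖ ≤ M * ‖laplacian ν μ f z‖
      + 4 * ∑ j, (M1 j * ‖lower ν μ j f z‖ + M2 j * ‖creation ν μ j f z‖ + M3 j * ‖f z‖) := by
  have hb : ∀ {x : ℂ} {B : ℝ}, ‖x‖ ≤ B → ‖(c : ℂ) * x‖ ≤ B := fun hx => by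
    rw [norm_mul, Complex.norm_real]
    exact (mul_le_of_le_one_left (norm_nonneg _) hc).trans hx
  rw [laplacian_dilate_mul ν μ hp hf]
  refine (norm_sub_le _ _).trans (add_le_add ?_ ?_)
  · rw [norm_mul]
    exact mul_le_mul_of_nonneg_right (hM _) (norm_nonneg _)
  rw [norm_mul, RCLike.norm_ofNat]
  refine mul_le_mul_of_nonneg_left ((norm_sum_le _ _).trans (Finset.sum_le_sum fun j _ => ?_))
    (by norm_num)
  refine (norm_sub_le _ _).trans (add_le_add ((norm_add_le _ _).trans (add_le_add ?_ ?_)) ?_)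
  · rw [norm_neg, norm_mul]
    exact mul_le_mul_of_nonneg_right (hb (hM1 j _)) (norm_nonneg _)
  · rw [norm_mul]
    exact mul_le_mul_of_nonneg_right (hb (hM2 j _)) (norm_nonneg _)
  · rw [norm_mul]
    exact mul_le_mul_of_nonneg_right (hb (hb (hM3 j _))) (norm_nonneg _)

theorem tendsto_laplacian_dilate_mul (ν μ : ℝ) {p f : (Fin n → ℂ) → ℂ} (hp : ContDiff ℝ ∞ p)
    (hp0 : p 0 = 1) (hf : ContDiff ℝ ∞ f) {t : ℕ → ℝ}
    (ht : Filter.Tendsto t Filter.atTop (nhds 0)) (z : Fin n → ℂ) :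
    Filter.Tendsto (fun k => laplacian ν μ (fun z => p ((t k : ℂ) • z) * f z) z) Filter.atTop
      (nhds (laplacian ν μ f z)) := by
  simp only [laplacian_dilate_mul ν μ hp hf]
  have hs : Continuous fun c : ℝ => (c : ℂ) • z := Complex.continuous_ofReal.smul continuous_const
  have hc : Continuous fun c : ℝ => p ((c : ℂ) • z) * laplacian ν μ f z
      - 4 * ∑ j, (-(c * dz (e j) p ((c : ℂ) • z) * lower ν μ j f z)
        + c * dzbar (e j) p ((c : ℂ) • z) * creation ν μ j f z
        - c * (c * dz (e j) (dzbar (e j) p) ((c : ℂ) • z)) * f z) := by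
    have h0 : Continuous fun c : ℝ => p ((c : ℂ) • z) := hp.continuous.comp hs
    have h1 : ∀ j : Fin n, Continuous fun c : ℝ => dz (e j) p ((c : ℂ) • z) :=
      fun j => (contDiff_dz hp).continuous.comp hs
    have h2 : ∀ j : Fin n, Continuous fun c : ℝ => dzbar (e j) p ((c : ℂ) • z) :=
      fun j => (contDiff_dzbar hp).continuous.comp hs
    have h3 : ∀ j : Fin n, Continuous fun c : ℝ => dz (e j) (dzbar (e j) p) ((c : ℂ) • z) :=
      fun j => (contDiff_dz (contDiff_dzbar hp)).continuous.comp hs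
    fun_prop
  have := (hc.tendsto 0).comp ht
  simpa [Function.comp_def, hp0] using this

theorem tendsto_integral_laplacian_dilate_mul {p : (Fin n → ℂ) → ℂ}
    (hp : ContDiff ℝ ∞ p ∧ HasCompactSupport p) (hp0 : p 0 = 1) {t : ℕ → ℝ}
    (ht : Filter.Tendsto t Filter.atTop (nhds 0)) (ht1 : ∀ k, |t k| ≤ 1) {ν μ : ℝ} (hμ : 0 < μ)
    {F : (Fin n → ℂ) → ℂ} (hF : MemLp F 2 volume) {f : (Fin n → ℂ) → ℂ}
    (hf : f ∈ hspan n ν μ) :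
    Filter.Tendsto
      (fun k => ∫ z, conj (laplacian ν μ (fun z => p ((t k : ℂ) • z) * f z) z) * F z) Filter.atTop
      (nhds (∫ z, conj (laplacian ν μ f z) * F z)) := by
  have H := opClosed_hspan (n := n) ν hμ.ne'
  have hfs := hspan_contDiff hf
  obtain ⟨M, hM⟩ := exists_bound_of_test hp
  choose M1 hM1 using fun j => exists_bound_of_test (opClosed_test.dz j hp)
  choose M2 hM2 using fun j => exists_bound_of_test (opClosed_test.dzbar j hp)
  choose M3 hM3 using fun j =>
    exists_bound_of_test (opClosed_test.dz j (opClosed_test.dzbar j hp))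
  refine tendsto_integral_of_dominated_convergence
    (fun z => (M * ‖laplacian ν μ f z‖ + 4 * ∑ j, (M1 j * ‖lower ν μ j f z‖
      + M2 j * ‖creation ν μ j f z‖ + M3 j * ‖f z‖)) * ‖F z‖) ?_ ?_ ?_ ?_
  · exact fun k => (contDiff_conj (contDiff_laplacian ν μ
      ((contDiff_dilate hp.1 _).mul hfs))).continuous.aestronglyMeasurable.mul
        hF.aestronglyMeasurable
  · have h1 : ∀ j ∈ Finset.univ, MemLp (fun z => M1 j * ‖lower ν μ j f z‖
        + M2 j * ‖creation ν μ j f z‖ + M3 j * ‖f z‖) 2 volume := fun j _ =>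
      (((hspan_memLp hμ (H.lower ν μ j hf)).norm.const_mul _).add
        ((hspan_memLp hμ (H.creation ν μ j hf)).norm.const_mul _)).add
        ((hspan_memLp hμ hf).norm.const_mul _)
    have h2 : MemLp (fun z => M * ‖laplacian ν μ f z‖ + 4 * ∑ j, (M1 j * ‖lower ν μ j f z‖
        + M2 j * ‖creation ν μ j f z‖ + M3 j * ‖f z‖)) 2 volume :=
      ((hspan_memLp hμ (laplacian_mem_hspan hμ.ne' hf)).norm.const_mul M).add
        ((memLp_finsetSum _ h1).const_mul 4)
    exact h2.integrable_mul hF.norm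
  · refine fun k => ae_of_all _ fun z => ?_
    rw [norm_mul, RCLike.norm_conj]
    exact mul_le_mul_of_nonneg_right
      (norm_laplacian_dilate_mul_le ν μ hp.1 hfs hM hM1 hM2 hM3 (ht1 k) z) (norm_nonneg _)
  · refine ae_of_all _ fun z => ?_
    exact ((Complex.continuous_conj.tendsto _).comp
      (tendsto_laplacian_dilate_mul ν μ hp.1 hp0 hfs ht z)).mul_const _

/-- The weak eigenvalue equation, tested on `C_c^∞`, extends to the span of the `h_{r,s}`. -/
theorem EigenEq.integral_hspan {ν μ : ℝ} (hμ : 0 < μ) {c : ℂ} {F : L2 n} (hF : EigenEq ν μ c F)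
    {f : (Fin n → ℂ) → ℂ} (hf : f ∈ hspan n ν μ) :
    ∫ z, conj (laplacian ν μ f z) * F z = c * ∫ z, conj (f z) * F z := by
  let χ : ContDiffBump (0 : Fin n → ℂ) := ⟨1, 2, one_pos, one_lt_two⟩
  obtain ⟨p, hp, hp0⟩ : ∃ p : (Fin n → ℂ) → ℂ,
      (ContDiff ℝ ∞ p ∧ HasCompactSupport p) ∧ p 0 = 1 := by
    refine ⟨fun z => (χ z : ℂ), ⟨Complex.ofRealCLM.contDiff.comp χ.contDiff,
      χ.hasCompactSupport.comp_left (g := fun x : ℝ => (x : ℂ)) Complex.ofReal_zero⟩, ?_⟩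
    have : χ 0 = 1 := χ.one_of_mem_closedBall (by simp [χ])
    simp [this]
  let t : ℕ → ℝ := fun k => 1 / ((k : ℝ) + 1)
  have ht : Filter.Tendsto t Filter.atTop (nhds 0) := tendsto_one_div_add_atTop_nhds_zero_nat
  have ht0 : ∀ k, 0 < t k := fun k => by positivity
  have ht1 : ∀ k, |t k| ≤ 1 := fun k => by
    rw [abs_of_pos (ht0 k)]
    exact div_le_one_of_le₀ (by linarith [(Nat.cast_nonneg k : (0 : ℝ) ≤ k)]) (by positivity)
  have htest : ∀ k, ContDiff ℝ ∞ (fun z : Fin n → ℂ => p ((t k : ℂ) • z) * f z) ∧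
      HasCompactSupport (fun z : Fin n → ℂ => p ((t k : ℂ) • z) * f z) := fun k =>
    ⟨(contDiff_dilate hp.1 _).mul (hspan_contDiff hf),
      (hp.2.comp_smul (Complex.ofReal_ne_zero.2 (ht0 k).ne')).mul_right⟩
  -- The weak equation holds for each cut-off function; both of its sides converge as the cutoff is
  -- dilated away.
  refine tendsto_nhds_unique
    (tendsto_integral_laplacian_dilate_mul hp hp0 ht ht1 hμ (Lp.memLp F) hf) ?_
  simp only [hF _ (htest _).1 (htest _).2]
  exact (tendsto_integral_dilate_mul hp hp0 ht hμ (Lp.memLp F) hf).const_mul c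

end Cutoff

/-! ### Distributional eigenspaces and the Hilbert sum. -/

section Eigenspaces

variable {n : ℕ}

theorem inner_toLp {f : (Fin n → ℂ) → ℂ} (hf : MemLp f 2 volume) (F : L2 n) :
    inner ℂ hf.toLp F = ∫ z, conj (f z) * F z := by
  rw [L2.inner_def]
  refine integral_congr_ae ?_
  filter_upwards [hf.coeFn_toLp] with z hz
  rw [hz, RCLike.inner_apply, mul_comm]

theorem memLp_of_test {f : (Fin n → ℂ) → ℂ} (hf : ContDiff ℝ ∞ f ∧ HasCompactSupport f) :
    MemLp f 2 volume :=
  hf.1.continuous.memLp_of_hasCompactSupport hf.2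

theorem test_laplacian (ν μ : ℝ) {f : (Fin n → ℂ) → ℂ}
    (hf : ContDiff ℝ ∞ f ∧ HasCompactSupport f) :
    ContDiff ℝ ∞ (laplacian ν μ f) ∧ HasCompactSupport (laplacian ν μ f) := by
  have h2 : ∀ j, ContDiff ℝ ∞ (creation ν μ j (lower ν μ j f)) ∧
      HasCompactSupport (creation ν μ j (lower ν μ j f)) := fun j =>
    opClosed_test.creation ν μ j (opClosed_test.lower ν μ j hf)
  refine ⟨contDiff_laplacian ν μ hf.1, ?_⟩
  rw [funext (laplacian_eq ν μ hf.1)]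
  have h3 : HasCompactSupport (∑ j, creation ν μ j (lower ν μ j f)) :=
    Finset.sum_induction _ HasCompactSupport (fun _ _ => HasCompactSupport.add)
      HasCompactSupport.zero fun j _ => (h2 j).2
  rw [Finset.sum_fn] at h3
  exact HasCompactSupport.sub h3.mul_left hf.2.mul_left

theorem eigenEq_iff (ν μ : ℝ) (c : ℂ) (F : L2 n) : EigenEq ν μ c F ↔
    ∀ (φ : (Fin n → ℂ) → ℂ) (hφ : ContDiff ℝ ∞ φ ∧ HasCompactSupport φ),
      inner ℂ (memLp_of_test (test_laplacian ν μ hφ)).toLp F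
        = c * inner ℂ (memLp_of_test hφ).toLp F := by
  simp only [inner_toLp, EigenEq, and_imp]

/-- The distributional eigenspace. -/
def eigenspace (n : ℕ) (ν μ : ℝ) (c : ℂ) : Submodule ℂ (L2 n) where
  carrier := {F | EigenEq ν μ c F}
  add_mem' {F G} hF hG := by
    rw [Set.mem_ofPred_eq, eigenEq_iff] at *
    intro φ hφ
    rw [inner_add_right, inner_add_right, hF φ hφ, hG φ hφ, mul_add]
  zero_mem' := by
    rw [Set.mem_ofPred_eq, eigenEq_iff]
    intro φ hφ
    rw [inner_zero_right, inner_zero_right, mul_zero]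
  smul_mem' a F hF := by
    rw [Set.mem_ofPred_eq, eigenEq_iff] at *
    intro φ hφ
    rw [inner_smul_right, inner_smul_right, hF φ hφ, mul_left_comm]

/-- Since Δφ is again a test function, each instance of the weak equation equates two continuous
functionals of F. -/
theorem isClosed_eigenspace (ν μ : ℝ) (c : ℂ) :
    IsClosed (eigenspace n ν μ c : Set (L2 n)) := by
  have : (eigenspace n ν μ c : Set (L2 n)) = {F | ∀ (φ : (Fin n → ℂ) → ℂ)
      (hφ : ContDiff ℝ ∞ φ ∧ HasCompactSupport φ),
      inner ℂ (memLp_of_test (test_laplacian ν μ hφ)).toLp F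
        = c * inner ℂ (memLp_of_test hφ).toLp F} := by
    ext F; exact eigenEq_iff ν μ c F
  rw [this]
  simp only [Set.ofPred_forall]
  exact isClosed_iInter fun φ => isClosed_iInter fun hφ =>
    isClosed_eq (continuous_const.inner continuous_id)
      (continuous_const.mul (continuous_const.inner continuous_id))

theorem eigenEq_of_smooth {ν μ : ℝ} {c : ℂ} {f : (Fin n → ℂ) → ℂ} (hf : ContDiff ℝ ∞ f)
    {F : L2 n} (hF : F =ᵐ[volume] f) (h : ∀ z, laplacian ν μ f z = c * f z) :
    EigenEq ν μ c F := by
  intro φ h1 h2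
  have key := paired_test_smooth.integral_laplacian (f := φ) (g := f) ⟨h1, h2⟩ hf ν μ
  have e1 : ∀ g : (Fin n → ℂ) → ℂ, ∫ z, conj (g z) * F z = ∫ z, conj (g z) * f z := fun g =>
    integral_congr_ae (by filter_upwards [hF] with z hz; rw [hz])
  rw [e1, e1, key, ← integral_const_mul]
  refine integral_congr_ae (ae_of_all _ fun z => ?_)
  simp only [h]; ring

/-- The eigenvalue `-2μ(n+2l)`. -/
def level (n : ℕ) (μ : ℝ) (l : ℕ) : ℂ := ((-2 * μ * (n + 2 * (l : ℝ)) : ℝ) : ℂ)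

theorem level_injective {μ : ℝ} (hμ : 0 < μ) : Function.Injective (level n μ) := by
  intro l m hlm
  have h1 := Complex.ofReal_injective hlm
  have h2 := mul_left_cancel₀ (by linarith : -2 * μ ≠ 0) h1
  have h3 : (l : ℝ) = m := by linarith
  exact_mod_cast h3

theorem memLp_h (ν : ℝ) {μ : ℝ} (hμ : 0 < μ) (r s : Fin n → ℕ) : MemLp (h ν μ r s) 2 volume :=
  hspan_memLp hμ (h_mem_hspan ν μ r s)

theorem toLp_h_ne_zero (ν : ℝ) {μ : ℝ} (hμ : 0 < μ) (r s : Fin n → ℕ) :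
    (memLp_h ν hμ r s).toLp ≠ 0 := by
  intro H
  have h1 := (memLp_h ν hμ r s).coeFn_toLp
  rw [H] at h1
  have h2 : h ν μ r s =ᵐ[volume] (fun _ => 0) := h1.symm.trans (Lp.coeFn_zero ..)
  exact h_ne_zero ν hμ.ne' r s
    ((Continuous.ae_eq_iff_eq _ (contDiff_h ..).continuous continuous_const).1 h2)

theorem inner_toLp_h (ν : ℝ) {μ : ℝ} (hμ : 0 < μ) {r s r' s' : Fin n → ℕ}
    (hne : (r, s) ≠ (r', s')) :
    inner ℂ (memLp_h ν hμ r s).toLp (memLp_h ν hμ r' s').toLp = 0 := by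
  rw [inner_toLp, ← h_orthogonal ν hμ hne]
  refine integral_congr_ae ?_
  filter_upwards [(memLp_h ν hμ r' s').coeFn_toLp] with z hz
  rw [hz]

theorem eq_zero_of_inner_h {ν μ : ℝ} (hμ : 0 < μ) {F : L2 n}
    (hF : ∀ r s, inner ℂ (memLp_h ν hμ r s).toLp F = 0) : F = 0 :=
  (Lp.eq_zero_iff_ae_eq_zero).2 (ae_eq_zero_of_orthogonal_h hμ (Lp.memLp F) fun r s => by
    rw [← inner_toLp (memLp_h ν hμ r s), hF])

theorem topologicalClosure_span_h (ν : ℝ) {μ : ℝ} (hμ : 0 < μ) :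
    (Submodule.span ℂ {F : L2 n | ∃ r s, F = (memLp_h ν hμ r s).toLp}).topologicalClosure = ⊤ := by
  rw [Submodule.topologicalClosure_eq_top_iff, Submodule.eq_bot_iff]
  intro F hF
  exact eq_zero_of_inner_h (ν := ν) hμ fun r s =>
    (Submodule.mem_orthogonal _ F).1 hF _ (Submodule.subset_span ⟨r, s, rfl⟩)

/-- Trades the almost-everywhere description of the generators for actual elements `toLp`, on which
inner products can be computed. -/
theorem A_eq (ν : ℝ) {μ : ℝ} (hμ : 0 < μ) (l : ℕ) :
    A n ν μ l = (Submodule.span ℂ {F : L2 n | ∃ r s : Fin n → ℕ, len r = l ∧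
      F = (memLp_h ν hμ r s).toLp}).topologicalClosure := by
  rw [A]
  congr! 6 with F r
  refine exists_congr fun s => and_congr_right fun _ => ?_
  constructor
  · exact fun h1 => Lp.ext (h1.trans (memLp_h ν hμ r s).coeFn_toLp.symm)
  · exact fun h1 => h1 ▸ (memLp_h ν hμ r s).coeFn_toLp

theorem toLp_h_mem_A (ν : ℝ) {μ : ℝ} (hμ : 0 < μ) (r s : Fin n → ℕ) :
    (memLp_h ν hμ r s).toLp ∈ A n ν μ (len r) := by
  rw [A_eq ν hμ]
  exact Submodule.le_topologicalClosure _ (Submodule.subset_span ⟨r, s, rfl, rfl⟩)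

theorem isOrtho_A (ν : ℝ) {μ : ℝ} (hμ : 0 < μ) {l m : ℕ} (hlm : l ≠ m) :
    A n ν μ l ⟂ A n ν μ m := by
  rw [A_eq ν hμ, A_eq ν hμ, Submodule.isOrtho_iff_le, Submodule.orthogonal_closure]
  refine Submodule.topologicalClosure_minimal _ ?_ (Submodule.isClosed_orthogonal _)
  rw [← Submodule.isOrtho_iff_le, Submodule.isOrtho_span]
  rintro _ ⟨r, s, hr, rfl⟩ _ ⟨r', s', hr', rfl⟩
  refine inner_toLp_h ν hμ fun heq => hlm ?_
  rw [← hr, ← hr', (Prod.mk.inj heq).1]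

theorem isHilbertSum_A (ν : ℝ) {μ : ℝ} (hμ : 0 < μ) :
    IsHilbertSum ℂ (fun l : ℕ => A n ν μ l) (fun l : ℕ => (A n ν μ l).subtypeₗᵢ) := by
  have : ∀ l, CompleteSpace (A n ν μ l) := fun l =>
    (Submodule.isClosed_topologicalClosure _).completeSpace_coe
  refine IsHilbertSum.mkInternal _
    (OrthogonalFamily.of_pairwise fun l m hlm => isOrtho_A ν hμ hlm) ?_
  rw [← topologicalClosure_span_h ν hμ]
  refine Submodule.topologicalClosure_mono (Submodule.span_le.2 ?_)
  rintro _ ⟨r, s, rfl⟩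
  exact (le_iSup (fun l => A n ν μ l) (len r)) (toLp_h_mem_A ν hμ r s)

theorem A_le_eigenspace (ν : ℝ) {μ : ℝ} (hμ : 0 < μ) (l : ℕ) :
    A n ν μ l ≤ eigenspace n ν μ (level n μ l) := by
  rw [A_eq ν hμ]
  refine Submodule.topologicalClosure_minimal _ (Submodule.span_le.2 ?_) (isClosed_eigenspace ..)
  rintro _ ⟨r, s, rfl, rfl⟩
  exact eigenEq_of_smooth (contDiff_h ν μ r s) (memLp_h ν hμ r s).coeFn_toLp (laplacian_h ν μ r s)

/-- Testing with h_{r,s} gives level · ⟨h, F⟩ = c · ⟨h, F⟩, where the level comes out of the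
conjugate unchanged because it is real. -/
theorem EigenEq.inner_h_eq_zero {ν μ : ℝ} (hμ : 0 < μ) {c : ℂ} {F : L2 n}
    (hF : EigenEq ν μ c F) {r s : Fin n → ℕ} (hc : c ≠ level n μ (len r)) :
    inner ℂ (memLp_h ν hμ r s).toLp F = 0 := by
  have key := hF.integral_hspan hμ (h_mem_hspan ν μ r s)
  have e1 : ∀ z, conj (laplacian ν μ (h ν μ r s) z) * F z
      = level n μ (len r) * (conj (h ν μ r s z) * F z) := fun z => by
    rw [laplacian_h, map_mul, Complex.conj_ofReal, mul_assoc, level]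
  simp only [e1] at key
  rw [integral_const_mul, ← inner_toLp (memLp_h ν hμ r s)] at key
  refine (mul_eq_zero.1 ?_).resolve_left (sub_ne_zero.2 hc)
  rw [sub_mul]
  linear_combination -key

theorem mem_A_iff (ν : ℝ) {μ : ℝ} (hμ : 0 < μ) (l : ℕ) (F : L2 n) :
    F ∈ A n ν μ l ↔ EigenEq ν μ (level n μ l) F := by
  refine ⟨fun hF => A_le_eigenspace ν hμ l hF, fun hF => ?_⟩
  have : CompleteSpace (A n ν μ l) :=
    (Submodule.isClosed_topologicalClosure _).completeSpace_coe
  -- The component Q orthogonal to A_l still solves the equation. It is orthogonal to h_{r,s} by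
  -- construction when |r| = l and by the eigenvalue mismatch otherwise, so completeness gives Q =
  -- 0.
  obtain ⟨P, hP, Q, hQ, rfl⟩ := Submodule.exists_add_mem_mem_orthogonal (K := A n ν μ l) F
  have hQ' : EigenEq ν μ (level n μ l) Q := by
    have := (eigenspace n ν μ (level n μ l)).sub_mem hF (A_le_eigenspace ν hμ l hP)
    rwa [add_sub_cancel_left] at this
  have hQ0 : Q = 0 := by
    refine eq_zero_of_inner_h (ν := ν) hμ fun r s => ?_
    by_cases hr : l = len r
    · subst hr
      exact (Submodule.mem_orthogonal _ Q).1 hQ _ (toLp_h_mem_A ν hμ r s)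
    · exact hQ'.inner_h_eq_zero hμ ((level_injective hμ).ne hr)
  rw [hQ0, add_zero]; exact hP

theorem EigenEq.exists_level {ν μ : ℝ} (hμ : 0 < μ) {c : ℂ} {F : L2 n} (hF0 : F ≠ 0)
    (hF : EigenEq ν μ c F) : ∃ l : ℕ, c = level n μ l := by
  by_contra! hc
  exact hF0 (eq_zero_of_inner_h (ν := ν) hμ fun r s => hF.inner_h_eq_zero hμ (hc _))

/-- This is where n ≥ 1 matters: for n = 0 only l = 0 is attained. -/
theorem exists_len_eq (hn : 1 ≤ n) (l : ℕ) : ∃ r : Fin n → ℕ, len r = l :=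
  ⟨Pi.single ⟨0, hn⟩ l, by simp [len]⟩

end Eigenspaces

end Magnetic

end

theorem mainTheorem2 (n : ℕ) (hn : 1 ≤ n) (ν μ : ℝ) (hμ : 0 < μ) :
    -- product formula
    (∀ (r s : Fin n → ℕ) (z : Fin n → ℂ),
      Magnetic.h ν μ r s z =
        Complex.exp (-(Complex.I * ν / 2) * (Magnetic.sqNorm z : ℂ)) *
          (((μ : ℂ) ^ Magnetic.len s)⁻¹ *
            ∏ j, (Complex.exp (-((μ : ℂ) / 2) * ((‖z j‖ ^ 2 : ℝ) : ℂ)) *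
              Magnetic.complexHermite μ (r j) (s j) (z j)))) ∧
    -- each function is smooth and an eigenfunction
    (∀ r s : Fin n → ℕ, ContDiff ℝ ∞ (Magnetic.h ν μ r s) ∧
      ∀ z, Magnetic.laplacian ν μ (Magnetic.h ν μ r s) z =
        ((-2 * μ * (n + 2 * (Magnetic.len r : ℝ)) : ℝ) : ℂ) * Magnetic.h ν μ r s z) ∧
    -- complete orthogonal system
    (∃ hL : ∀ r s : Fin n → ℕ, MemLp (Magnetic.h ν μ r s) 2 (volume : Measure (Fin n → ℂ)),
      (∀ r s, (hL r s).toLp ≠ 0) ∧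
      (∀ r s r' s', (r, s) ≠ (r', s') →
        inner ℂ (hL r s).toLp (hL r' s').toLp = 0) ∧
      (Submodule.span ℂ {F : Magnetic.L2 n | ∃ r s, F = (hL r s).toLp}).topologicalClosure = ⊤) ∧
    -- orthogonal Hilbert sum decomposition
    IsHilbertSum ℂ (fun l : ℕ => Magnetic.A n ν μ l)
      (fun l : ℕ => (Magnetic.A n ν μ l).subtypeₗᵢ) ∧
    -- the summands are the eigenspaces
    (∀ (l : ℕ) (F : Magnetic.L2 n), F ∈ Magnetic.A n ν μ l ↔
      Magnetic.EigenEq ν μ ((-2 * μ * (n + 2 * (l : ℝ)) : ℝ) : ℂ) F) ∧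
    -- the eigenvalues in the sense of distributions
    (∀ c : ℂ, (∃ F : Magnetic.L2 n, F ≠ 0 ∧ Magnetic.EigenEq ν μ c F) ↔
      ∃ l : ℕ, c = ((-2 * μ * (n + 2 * (l : ℝ)) : ℝ) : ℂ)) ∧
    -- the eigenvalues with smooth square-integrable eigenfunctions
    (∀ c : ℂ, (∃ f : (Fin n → ℂ) → ℂ, ContDiff ℝ ∞ f ∧ MemLp f 2 (volume : Measure (Fin n → ℂ)) ∧
        f ≠ 0 ∧ ∀ z, Magnetic.laplacian ν μ f z = c * f z) ↔
      ∃ l : ℕ, c = ((-2 * μ * (n + 2 * (l : ℝ)) : ℝ) : ℂ)) := by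
  refine ⟨fun r s z => Magnetic.h_product_formula ν hμ.ne' r s z,
    fun r s => ⟨Magnetic.contDiff_h ν μ r s, Magnetic.laplacian_h ν μ r s⟩,
    ⟨Magnetic.memLp_h ν hμ, Magnetic.toLp_h_ne_zero ν hμ,
      fun r s r' s' => Magnetic.inner_toLp_h ν hμ, Magnetic.topologicalClosure_span_h ν hμ⟩,
    Magnetic.isHilbertSum_A ν hμ, Magnetic.mem_A_iff ν hμ, fun c => ⟨?_, ?_⟩, fun c => ⟨?_, ?_⟩⟩
  · rintro ⟨F, hF0, hF⟩
    exact hF.exists_level hμ hF0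
  · rintro ⟨l, rfl⟩
    obtain ⟨r, rfl⟩ := Magnetic.exists_len_eq hn l
    exact ⟨_, Magnetic.toLp_h_ne_zero ν hμ r 0,
      (Magnetic.mem_A_iff ν hμ _ _).1 (Magnetic.toLp_h_mem_A ν hμ r 0)⟩
  · rintro ⟨f, hf, hfL, hf0, hfc⟩
    refine (Magnetic.eigenEq_of_smooth hf hfL.coeFn_toLp hfc).exists_level hμ fun H => hf0 ?_
    have h1 := hfL.coeFn_toLp
    rw [H] at h1
    -- A continuous function that vanishes almost everywhere vanishes identically, so a nonzero
    -- smooth f has a nonzero class.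
    have h2 : f =ᵐ[volume] (fun _ => 0) := h1.symm.trans (Lp.coeFn_zero ..)
    exact (Continuous.ae_eq_iff_eq _ hf.continuous continuous_const).1 h2
  · rintro ⟨l, rfl⟩
    obtain ⟨r, rfl⟩ := Magnetic.exists_len_eq hn l
    exact ⟨_, Magnetic.contDiff_h ν μ r 0, Magnetic.memLp_h ν hμ r 0,
      Magnetic.h_ne_zero ν hμ.ne' r 0, Magnetic.laplacian_h ν μ r 0⟩
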